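/- Call a complex random variable $\gamma$ *rigidly sub-Gaussian* if $e^{i\theta}\gamma$ has the same law as $\gamma$ for every $\theta\in\mathbb R$, and, for every integer $k\ge 0$, $\mathbb E|\gamma|^{2k}<\infty$ and $\mathbb E|\gamma|^{2k}\le k!\,(\mathbb E|\gamma|^2)^k$ (for example, a circularly symmetric complex Gaussian). A random symmetric tensor $B\in\mathrm{Sym}_p(\mathbb C^d)\subseteq(\mathbb C^d)^{\otimes p}$ comes from *Model $S_{\mathbb C}$* if its entries $B_{i_1,\dots,i_p}$ with $i_1\le\dots\le i_p$ are independent and, for some rigidly sub-Gaussian $\gamma$ with $\mathbb E|\gamma|^2=1/d$, each entry $B_{i_1,\dots,i_p}$ has the same law as $\sqrt{s(i)/p!}\;\gamma$, where $s(i)$ is the number of permutations in $\mathfrak S_p$ that fix the tuple $i=(i_1,\dots,i_p)$. For $T\in(\mathbb C^d)^{\otimes p}$ let $$\|T\|_{\mathrm{HS}}=\Big(\sum_{i_1,\dots,i_p}|T_{i_1,\dots,i_p}|^2\Big)^{1/2},\qquad \|T\|_{\mathrm{inj}}=\max_{\substack{x_1,\dots,x_p\in\mathbb C^d\\ \|x_j\|_2=1}}\Big|\sum_{i_1,\dots,i_p}\overline{T_{i_1,\dots,i_p}}\,(x_1)_{i_1}\cdots(x_p)_{i_p}\Big|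 .$$ **Corollary D.3.** For every $\epsilon>0$ and every integer $d\ge 2$ there is $p_0=p_0(\epsilon,d)$ such that for all $p\ge p_0$ and every random tensor $B$ from Model $S_{\mathbb C}$, the normalised state $\psi_B=B/\|B\|_{\mathrm{HS}}$ (with $\psi_B=0$ where $B=0$) satisfies $$\mathbb E\,\|\psi_B\|_{\mathrm{inj}}\;\le\;(1+\epsilon)\sqrt{\frac{(d-1)!\,(d-1)\log p}{p^{\,d-1}}} .$$ -/

import Mathlib

open MeasureTheory ProbabilityTheory

noncomputable section

namespace SymTensor

/-- A tensor in `(ℂ^d)^{⊗p}`, given by its entries `T_{i_1,…,i_p}`. -/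
abbrev Tensor (d p : ℕ) : Type := (Fin p → Fin d) → ℂ

/-- `⟨T, x_1 ⊗ ⋯ ⊗ x_p⟩ = ∑ conj(T_{i_1,…,i_p}) (x_1)_{i_1} ⋯ (x_p)_{i_p}`. -/
def pairing {d p : ℕ} (T : Tensor d p) (x : Fin p → EuclideanSpace ℂ (Fin d)) : ℂ :=
  ∑ i : Fin p → Fin d, (starRingEnd ℂ) (T i) * ∏ j : Fin p, x j (i j)

/-- The injective norm: the maximum of `|⟨T, x_1 ⊗ ⋯ ⊗ x_p⟩|` over unit vectors `x_1, …, x_p`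
of `ℂ^d` (for `d ≥ 1` this set of values is nonempty and compact, so its supremum is its
maximum). -/
def injNorm {d p : ℕ} (T : Tensor d p) : ℝ :=
  sSup {r : ℝ | ∃ x : Fin p → EuclideanSpace ℂ (Fin d), (∀ j, ‖x j‖ = 1) ∧ r = ‖pairing T x‖}

/-- The Hilbert-Schmidt (Frobenius) norm. -/
def hsNorm {d p : ℕ} (T : Tensor d p) : ℝ :=
  Real.sqrt (∑ i : Fin p → Fin d, ‖T i‖ ^ 2)

/-- The normalised tensor `T / ‖T‖_HS` (equal to `0` if `T = 0`). -/
def normalise {d p : ℕ} (T : Tensor d p) : Tensor d p :=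
  fun i => T i / (hsNorm T : ℂ)

/-- Membership in `Sym_p(ℂ^d)`: the entries are invariant under permutations of the indices. -/
def IsSymmetric {d p : ℕ} (T : Tensor d p) : Prop :=
  ∀ (σ : Equiv.Perm (Fin p)) (i : Fin p → Fin d), T (i ∘ σ) = T i

/-- The order of the stabiliser of the tuple `(i_1,…,i_p)` in the symmetric group `𝔖_p`. -/
def stabCard {d p : ℕ} (i : Fin p → Fin d) : ℕ :=
  Nat.card {σ : Equiv.Perm (Fin p) // i ∘ σ = i}

/-- A `ℂ`-rigidly sub-Gaussian random variable: circularly symmetric, with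
`𝔼|Y|^{2k} ≤ k! (𝔼|Y|²)^k` (in particular these moments are finite) for all `k`. -/
structure IsRigidlySubGaussian {Ω : Type*} [MeasurableSpace Ω] (μ : Measure Ω) (Y : Ω → ℂ) :
    Prop where
  circular : ∀ θ : ℝ, IdentDistrib Y (fun ω => Complex.exp (θ * Complex.I) * Y ω) μ μ
  moment_integrable : ∀ k : ℕ, Integrable (fun ω => ‖Y ω‖ ^ (2 * k)) μ
  moment_le : ∀ k : ℕ,
    ∫ ω, ‖Y ω‖ ^ (2 * k) ∂μ ≤ (k.factorial : ℝ) * (∫ ω, ‖Y ω‖ ^ 2 ∂μ) ^ k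

/-- The symmetric random tensor `B` on `(Ω, μ)` comes from Model `S_ℂ` with underlying random
variable `γ` (defined on some probability space `(Ω', μ')`). Independence up to symmetry:
the entries with nondecreasing index tuples `i_1 ≤ ⋯ ≤ i_p`, one for each orbit of the symmetric
group, are independent. -/
structure IsModelSC {d p : ℕ} {Ω : Type*} [MeasurableSpace Ω] (μ : Measure Ω)
    (B : Ω → Tensor d p) {Ω' : Type*} [MeasurableSpace Ω'] (μ' : Measure Ω') (γ : Ω' → ℂ) :
    Prop where
  rigid : IsRigidlySubGaussian μ' γ
  variance : ∫ ω, ‖γ ω‖ ^ 2 ∂μ' = 1 / (d : ℝ)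
  symmetric : ∀ ω, IsSymmetric (B ω)
  indep : iIndepFun (fun (i : {i : Fin p → Fin d // Monotone i}) (ω : Ω) => B ω i.1) μ
  law : ∀ i : Fin p → Fin d,
    IdentDistrib (fun ω => B ω i)
      (fun ω => (Real.sqrt ((stabCard i : ℝ) / (p.factorial : ℝ)) : ℂ) * γ ω) μ μ'

end SymTensor

end

/-! By Banach's theorem (`exists_injNorm_eq`), the injective norm of a symmetric tensor is the
maximum over the unit sphere of the modulus of the degree-`p` form `diagPairing`. At a fixed unit
vector this form is a sum of independent rigidly sub-Gaussian variables. The weights `s(i)/p!`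
cancel the orbit sizes, so the total variance is `1/d` and the `2k`-th moment is at most `k! / d^k`
(`IsModelSC.diagPairing_moment`).

Near a maximizer the form varies only on the scale `1/√p` (`le_norm_diagPairing_add`). A grid of
that mesh in projective space, of real dimension `2(d-1)`, therefore has `O(p^(d-1))` points and
almost detects the maximum (`exists_netUnit_le`). Summing moments of order `k ≈ (d-1) log p` over
the net bounds the expected injective norm by about `√(k/d)`, because Stirling's `e^(-k)` beats the
size of the net (`net_term_le`).

The squared Hilbert-Schmidt norm concentrates at `N/d`, where `N ≥ p^(d-1)/(d-1)!` counts the orbits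
(`IsModelSC.hsNorm_lower_tail`). In the quotient `√(k/N)` the factor `d` cancels. The exceptional
event costs `O(1/N)`, which is of lower order, since the normalised norm never exceeds one. -/

noncomputable section

namespace SymTensor

/-! ### Moments of sums of independent rigidly sub-Gaussian variables. -/

section Moments

variable {Ω : Type*} [MeasurableSpace Ω] {μ : Measure Ω}

lemma IsRigidlySubGaussian.aemeasurable {Y : Ω → ℂ} (h : IsRigidlySubGaussian μ Y) :
    AEMeasurable Y μ := (h.circular 0).aemeasurable_fst

lemma IsRigidlySubGaussian.of_identDistrib {Ω' : Type*} [MeasurableSpace Ω'] {μ' : Measure Ω'}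
    {X : Ω → ℂ} {Y : Ω' → ℂ} (h : IdentDistrib X Y μ μ') (hY : IsRigidlySubGaussian μ' Y) :
    IsRigidlySubGaussian μ X := by
  have hpow : ∀ k : ℕ, IdentDistrib (fun ω => ‖X ω‖ ^ k) (fun ω => ‖Y ω‖ ^ k) μ μ' := fun k =>
    h.comp (u := fun z : ℂ => ‖z‖ ^ k) (by fun_prop)
  refine ⟨fun θ => ?_, fun k => ?_, fun k => ?_⟩
  · exact h.trans ((hY.circular θ).trans (h.symm.const_mul _))
  · exact (hpow (2 * k)).integrable_iff.2 (hY.moment_integrable k)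
  · rw [(hpow (2 * k)).integral_eq, (hpow 2).integral_eq]
    exact hY.moment_le k

lemma IsRigidlySubGaussian.const_mul {Y : Ω → ℂ} (h : IsRigidlySubGaussian μ Y) (a : ℂ) :
    IsRigidlySubGaussian μ (fun ω => a * Y ω) := by
  refine ⟨fun θ => ?_, fun k => ?_, fun k => ?_⟩
  · have := (h.circular θ).const_mul a
    simpa only [mul_left_comm] using this
  · simp only [norm_mul, mul_pow]
    exact (h.moment_integrable k).const_mul _
  · simp only [norm_mul, mul_pow, integral_const_mul]
    calc ‖a‖ ^ (2 * k) * ∫ ω, ‖Y ω‖ ^ (2 * k) ∂μ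
        ≤ ‖a‖ ^ (2 * k) * ((k.factorial : ℝ) * (∫ ω, ‖Y ω‖ ^ 2 ∂μ) ^ k) := by
          gcongr
          exact h.moment_le k
      _ = _ := by rw [pow_mul]; ring

lemma integrable_pow_mul_conj_pow [IsFiniteMeasure μ] {Y : Ω → ℂ} (hm : AEMeasurable Y μ)
    (hi : ∀ k : ℕ, Integrable (fun ω => ‖Y ω‖ ^ (2 * k)) μ) (a b : ℕ) :
    Integrable (fun ω => Y ω ^ a * (starRingEnd ℂ) (Y ω) ^ b) μ := by
  -- Only even moments are given, so the domination is `x ≤ 1 + x²` with `x = ‖Y‖ ^ (a + b)`.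
  refine ((integrable_const (1 : ℝ)).add (hi (a + b))).mono' ?_ (.of_forall fun ω => ?_)
  · have : Measurable (fun z : ℂ => z ^ a * (starRingEnd ℂ) z ^ b) :=
      (by fun_prop : Continuous _).measurable
    exact (this.comp_aemeasurable hm).aestronglyMeasurable
  · simp only [norm_mul, norm_pow, RCLike.norm_conj, ← pow_add, Pi.add_apply]
    rw [mul_comm 2, pow_mul]
    nlinarith [sq_nonneg (‖Y ω‖ ^ (a + b) - 1)]

/-- Rotation by `θ` multiplies the integrand by `exp(i(a-b)θ)`. At `θ = π/(a-b)` this factor is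
`-1`, so the integral equals its own negative. -/
lemma IsRigidlySubGaussian.integral_pow_mul_conj_pow {Y : Ω → ℂ} (h : IsRigidlySubGaussian μ Y)
    {a b : ℕ} (hab : a ≠ b) :
    ∫ ω, Y ω ^ a * (starRingEnd ℂ) (Y ω) ^ b ∂μ = 0 := by
  have hab' : (a : ℝ) - b ≠ 0 := sub_ne_zero.2 (by exact_mod_cast hab)
  set θ : ℝ := Real.pi / (a - b) with hθ
  have hmeas : Measurable (fun z : ℂ => z ^ a * (starRingEnd ℂ) z ^ b) :=
    (by fun_prop : Continuous _).measurable
  have key := ((h.circular θ).comp hmeas).integral_eq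
  simp only [Function.comp_def] at key
  have hrot : ∀ ω, (Complex.exp (θ * Complex.I) * Y ω) ^ a *
      (starRingEnd ℂ) (Complex.exp (θ * Complex.I) * Y ω) ^ b
      = (-1) * (Y ω ^ a * (starRingEnd ℂ) (Y ω) ^ b) := by
    intro ω
    have hc : (starRingEnd ℂ) (Complex.exp (θ * Complex.I)) = Complex.exp (-(θ * Complex.I)) := by
      rw [← Complex.exp_conj]; simp
    have : Complex.exp (θ * Complex.I) ^ a * Complex.exp (-(θ * Complex.I)) ^ b = -1 := by
      rw [← Complex.exp_nat_mul, ← Complex.exp_nat_mul, ← Complex.exp_add, ← Complex.exp_pi_mul_I]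
      congr 1
      have : ((a : ℂ) - b) * θ = Real.pi := by
        rw [hθ]
        have : ((a : ℂ) - b) ≠ 0 := by exact_mod_cast hab'
        push_cast
        field_simp
      rw [← this]; ring
    rw [map_mul, mul_pow, mul_pow, hc]
    calc _ = (Complex.exp (θ * Complex.I) ^ a * Complex.exp (-(θ * Complex.I)) ^ b) *
          (Y ω ^ a * (starRingEnd ℂ) (Y ω) ^ b) := by ring
      _ = _ := by rw [this]
  simp only [hrot, integral_const_mul] at key
  linear_combination key / 2

lemma ofReal_norm_pow_two_mul (z : ℂ) (k : ℕ) :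
    ((‖z‖ ^ (2 * k) : ℝ) : ℂ) = z ^ k * (starRingEnd ℂ) z ^ k := by
  rw [← mul_pow, Complex.mul_conj, Complex.normSq_eq_norm_sq, pow_mul]
  push_cast
  rfl

lemma norm_add_pow_integrable [IsFiniteMeasure μ] {S Y : Ω → ℂ} (hS : AEMeasurable S μ)
    (hY : AEMeasurable Y μ)
    (hSi : ∀ k : ℕ, Integrable (fun ω => ‖S ω‖ ^ (2 * k)) μ)
    (hYi : ∀ k : ℕ, Integrable (fun ω => ‖Y ω‖ ^ (2 * k)) μ) (k : ℕ) :
    Integrable (fun ω => ‖S ω + Y ω‖ ^ (2 * k)) μ := by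
  refine (((hSi k).add (hYi k)).const_mul (2 ^ (2 * k - 1))).mono' ?_ (.of_forall fun ω => ?_)
  · exact ((hS.add hY).norm.pow_const _).aestronglyMeasurable
  · rw [Real.norm_of_nonneg (by positivity)]
    refine le_trans (pow_le_pow_left₀ (norm_nonneg _) (norm_add_le _ _) _) ?_
    exact add_pow_le (norm_nonneg _) (norm_nonneg _) _

/-- Moments of a sum of independent variables, one of which is rigidly sub-Gaussian: the cross
terms vanish. -/
lemma integral_norm_add_pow_le [IsProbabilityMeasure μ] {S Y : Ω → ℂ} (hS : AEMeasurable S μ)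
    (hSi : ∀ k : ℕ, Integrable (fun ω => ‖S ω‖ ^ (2 * k)) μ) {u : ℝ} (hu : 0 ≤ u)
    (hSm : ∀ k : ℕ, ∫ ω, ‖S ω‖ ^ (2 * k) ∂μ ≤ (k.factorial : ℝ) * u ^ k)
    (hY : IsRigidlySubGaussian μ Y) (hind : IndepFun S Y μ) (k : ℕ) :
    ∫ ω, ‖S ω + Y ω‖ ^ (2 * k) ∂μ ≤ (k.factorial : ℝ) * (u + ∫ ω, ‖Y ω‖ ^ 2 ∂μ) ^ k := by
  set v := ∫ ω, ‖Y ω‖ ^ 2 ∂μ with hv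
  have hv0 : 0 ≤ v := integral_nonneg fun ω => by positivity
  have hYi := hY.moment_integrable
  have hexp : ∀ ω, ((‖S ω + Y ω‖ ^ (2 * k) : ℝ) : ℂ) =
      ∑ a ∈ Finset.range (k + 1), ∑ b ∈ Finset.range (k + 1),
        ((k.choose a : ℂ) * (k.choose b : ℂ)) * ((S ω ^ a * (starRingEnd ℂ) (S ω) ^ b) *
          (Y ω ^ (k - a) * (starRingEnd ℂ) (Y ω) ^ (k - b))) := by
    intro ω
    rw [ofReal_norm_pow_two_mul, map_add, add_pow, add_pow, Finset.sum_mul_sum]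
    refine Finset.sum_congr rfl fun a _ => Finset.sum_congr rfl fun b _ => ?_
    ring
  have hg : ∀ a b : ℕ, Measurable (fun z : ℂ => z ^ a * (starRingEnd ℂ) z ^ b) := fun a b =>
    (by fun_prop : Continuous _).measurable
  have hii : ∀ a b : ℕ, IndepFun (fun ω => S ω ^ a * (starRingEnd ℂ) (S ω) ^ b)
      (fun ω => Y ω ^ (k - a) * (starRingEnd ℂ) (Y ω) ^ (k - b)) μ := fun a b =>
    hind.comp (hg a b) (hg (k - a) (k - b))
  have hint : ∀ a b : ℕ, Integrable (fun ω => (S ω ^ a * (starRingEnd ℂ) (S ω) ^ b) *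
      (Y ω ^ (k - a) * (starRingEnd ℂ) (Y ω) ^ (k - b))) μ := fun a b =>
    (hii a b).integrable_mul (integrable_pow_mul_conj_pow hS hSi a b)
      (integrable_pow_mul_conj_pow hY.aemeasurable hYi _ _)
  have hval : ∀ a b : ℕ, ∫ ω, (S ω ^ a * (starRingEnd ℂ) (S ω) ^ b) *
      (Y ω ^ (k - a) * (starRingEnd ℂ) (Y ω) ^ (k - b)) ∂μ =
      (∫ ω, S ω ^ a * (starRingEnd ℂ) (S ω) ^ b ∂μ) *
      ∫ ω, Y ω ^ (k - a) * (starRingEnd ℂ) (Y ω) ^ (k - b) ∂μ := fun a b =>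
    (hii a b).integral_fun_mul_eq_mul_integral
      (integrable_pow_mul_conj_pow hS hSi a b).aestronglyMeasurable
      (integrable_pow_mul_conj_pow hY.aemeasurable hYi _ _).aestronglyMeasurable
  have hdiag : ∫ ω, ‖S ω + Y ω‖ ^ (2 * k) ∂μ = ∑ a ∈ Finset.range (k + 1),
      (k.choose a : ℝ) ^ 2 * ((∫ ω, ‖S ω‖ ^ (2 * a) ∂μ) * ∫ ω, ‖Y ω‖ ^ (2 * (k - a)) ∂μ) := by
    apply Complex.ofReal_injective
    rw [← integral_complex_ofReal]
    simp_rw [hexp]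
    rw [integral_finsetSum _ fun a _ => integrable_finsetSum _ fun b _ => (hint a b).const_mul _,
      Complex.ofReal_sum]
    refine Finset.sum_congr rfl fun a ha => ?_
    rw [integral_finsetSum _ fun b _ => (hint a b).const_mul _, Finset.sum_eq_single a]
    · rw [integral_const_mul, hval]
      simp_rw [← ofReal_norm_pow_two_mul]
      rw [integral_complex_ofReal, integral_complex_ofReal]
      push_cast
      ring
    · intro b hb hba
      rw [Finset.mem_range] at ha hb
      rw [integral_const_mul, hval,
        hY.integral_pow_mul_conj_pow (a := k - a) (b := k - b) (by omega)]
      simp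
    · exact fun h => absurd ha h
  rw [hdiag, add_pow, Finset.mul_sum]
  refine Finset.sum_le_sum fun a ha => ?_
  have hak : a ≤ k := by rw [Finset.mem_range] at ha; omega
  calc (k.choose a : ℝ) ^ 2 * ((∫ ω, ‖S ω‖ ^ (2 * a) ∂μ) * ∫ ω, ‖Y ω‖ ^ (2 * (k - a)) ∂μ)
      ≤ (k.choose a : ℝ) ^ 2 * (((a.factorial : ℝ) * u ^ a) *
          (((k - a).factorial : ℝ) * v ^ (k - a))) := by
        gcongr
        · exact hSm a
        · exact hY.moment_le _
    -- One of the two binomial coefficients absorbs `a! (k-a)!` into `k!`; the other rebuilds the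
    -- binomial theorem. This is why the bound `k! u^k` is stable under independent sums.
    _ = ((k.choose a * a.factorial * (k - a).factorial : ℕ) : ℝ) *
          (u ^ a * v ^ (k - a) * (k.choose a : ℝ)) := by push_cast; ring
    _ = _ := by rw [Nat.choose_mul_factorial_mul_factorial hak]

lemma integral_norm_sum_pow_le [IsProbabilityMeasure μ] {ι : Type*} {X : ι → Ω → ℂ}
    (hX : ∀ i, IsRigidlySubGaussian μ (X i)) (hind : iIndepFun X μ) (s : Finset ι) :
    ∀ k : ℕ, Integrable (fun ω => ‖∑ i ∈ s, X i ω‖ ^ (2 * k)) μ ∧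
      ∫ ω, ‖∑ i ∈ s, X i ω‖ ^ (2 * k) ∂μ ≤
        (k.factorial : ℝ) * (∑ i ∈ s, ∫ ω, ‖X i ω‖ ^ 2 ∂μ) ^ k := by
  classical
  induction s using Finset.induction_on with
  | empty =>
    intro k
    rcases Nat.eq_zero_or_pos k with rfl | hk
    · simp
    · simp [hk.ne']
  | insert j s hj ih =>
    intro k
    have hm : AEMeasurable (fun ω => ∑ i ∈ s, X i ω) μ :=
      Finset.aemeasurable_fun_sum s fun i _ => (hX i).aemeasurable
    have hI : IndepFun (fun ω => ∑ i ∈ s, X i ω) (X j) μ := by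
      have := hind.indepFun_finsetSum_of_notMem₀ (fun i => (hX i).aemeasurable) hj
      convert this using 1
      ext ω; simp
    have hs : ∀ ω, ∑ i ∈ insert j s, X i ω = (∑ i ∈ s, X i ω) + X j ω := fun ω => by
      rw [Finset.sum_insert hj, add_comm]
    simp_rw [hs]
    refine ⟨norm_add_pow_integrable hm (hX j).aemeasurable (fun k => (ih k).1)
      (hX j).moment_integrable k, ?_⟩
    rw [Finset.sum_insert hj, add_comm (∫ ω, ‖X j ω‖ ^ 2 ∂μ)]
    exact integral_norm_add_pow_le hm (fun k => (ih k).1)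
      (Finset.sum_nonneg fun i _ => integral_nonneg fun ω => by positivity)
      (fun k => (ih k).2) (hX j) hI k

end Moments

/-! ### Orbits of index tuples under the symmetric group. -/

section Tuples

variable {d p : ℕ}

/-- The nondecreasing index tuples, one for each orbit of the symmetric group. -/
abbrev MonoTuple (d p : ℕ) : Type := {i : Fin p → Fin d // Monotone i}

lemma stabCard_pos (i : Fin p → Fin d) : 0 < stabCard i := by
  have : Nonempty {σ : Equiv.Perm (Fin p) // i ∘ σ = i} := ⟨⟨1, by simp⟩⟩
  exact Nat.card_pos

/-- The permutations carrying `m` to `m ∘ τ` form a coset of the stabiliser. -/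
lemma card_perm_comp_eq (m : Fin p → Fin d) (τ : Equiv.Perm (Fin p)) :
    Nat.card {σ : Equiv.Perm (Fin p) // m ∘ σ = m ∘ τ} = stabCard m := by
  refine Nat.card_congr ((Equiv.mulRight τ⁻¹).subtypeEquiv fun σ => ?_)
  constructor
  · intro h
    funext x
    have := congrFun h (τ⁻¹ x)
    simpa using this
  · intro h
    funext x
    have := congrFun h (τ x)
    simpa using this

/-- The nondecreasing rearrangement of an index tuple. -/
def sortTuple (i : Fin p → Fin d) : MonoTuple d p := ⟨i ∘ Tuple.sort i, Tuple.monotone_sort i⟩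

/-- Sorting ignores the order of the entries and fixes a nondecreasing tuple. Hence the fibres of
`sortTuple` are exactly the orbits. -/
lemma sortTuple_comp (m : MonoTuple d p) (σ : Equiv.Perm (Fin p)) :
    sortTuple (m.1 ∘ σ) = m := by
  apply Subtype.ext
  change (m.1 ∘ σ) ∘ Tuple.sort (m.1 ∘ σ) = m.1
  rw [Tuple.comp_perm_comp_sort_eq_comp_sort]
  have := (Tuple.comp_sort_eq_comp_iff_monotone (f := m.1) (σ := 1)).2 (by simpa using m.2)
  rw [← this]; simp

lemma exists_perm_sortTuple (i : Fin p → Fin d) :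
    ∃ τ : Equiv.Perm (Fin p), (sortTuple i).1 ∘ τ = i :=
  ⟨(Tuple.sort i)⁻¹, by funext x; simp [sortTuple]⟩

/-- A symmetric function of the index tuple can be summed orbit by orbit. -/
lemma sum_eq_sum_monoTuple {K : Type*} [Field K] [CharZero K] (F : (Fin p → Fin d) → K)
    (hF : ∀ (σ : Equiv.Perm (Fin p)) (i : Fin p → Fin d), F (i ∘ σ) = F i) :
    ∑ i, F i = ∑ m : MonoTuple d p, ((p.factorial : K) / (stabCard m.1 : K)) * F m.1 := by
  classical
  rw [← Finset.sum_fiberwise Finset.univ sortTuple F]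
  refine Finset.sum_congr rfl fun m _ => ?_
  have hs : (stabCard m.1 : K) ≠ 0 := by exact_mod_cast (stabCard_pos m.1).ne'
  have h1 : ∑ i with sortTuple i = m, F i
      = ((Finset.univ.filter fun i : Fin p → Fin d => sortTuple i = m).card : K) * F m.1 := by
    rw [Finset.sum_congr rfl (g := fun _ => F m.1), Finset.sum_const, nsmul_eq_mul]
    intro i hi
    rw [Finset.mem_filter] at hi
    obtain ⟨τ, hτ⟩ := exists_perm_sortTuple i
    rw [hi.2] at hτ
    rw [← hτ, hF]
  -- Orbit-stabiliser: sort the permutations by the value of `m ∘ σ`; each class has the size of the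
  -- stabiliser.
  have h2 : (Finset.univ : Finset (Equiv.Perm (Fin p))).card =
      ∑ i ∈ Finset.univ.filter fun i : Fin p → Fin d => sortTuple i = m,
        (Finset.univ.filter fun σ : Equiv.Perm (Fin p) => m.1 ∘ σ = i).card :=
    Finset.card_eq_sum_card_fiberwise fun σ _ => by simp [sortTuple_comp]
  have h3 : ∀ i ∈ Finset.univ.filter fun i : Fin p → Fin d => sortTuple i = m,
      (Finset.univ.filter fun σ : Equiv.Perm (Fin p) => m.1 ∘ σ = i).card = stabCard m.1 := by
    intro i hi
    rw [Finset.mem_filter] at hi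
    obtain ⟨τ, hτ⟩ := exists_perm_sortTuple i
    rw [hi.2] at hτ
    rw [← card_perm_comp_eq m.1 τ, Nat.card_eq_fintype_card, Fintype.card_subtype, hτ]
  rw [Finset.sum_congr rfl h3, Finset.sum_const, smul_eq_mul, Finset.card_univ,
    Fintype.card_perm, Fintype.card_fin] at h2
  rw [h1, h2]
  push_cast
  field_simp

/-- Nondecreasing tuples surject onto multisets, which stars and bars counts. A lower bound is
enough, as the number of orbits enters the final estimate only through denominators. -/
lemma card_monoTuple_ge (hd : 1 ≤ d) :
    (p : ℝ) ^ (d - 1) / ((d - 1).factorial : ℝ) ≤ (Fintype.card (MonoTuple d p) : ℝ) := by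
  let f : MonoTuple d p → Sym (Fin d) p := fun m =>
    ⟨Multiset.map m.1 Finset.univ.val, by simp⟩
  have hf : Function.Surjective f := by
    rintro ⟨s, hs⟩
    induction s using Quotient.inductionOn with
    | h l =>
      have hl : l.length = p := by simpa using hs
      subst hl
      refine ⟨sortTuple l.get, Subtype.ext ?_⟩
      change Multiset.map (l.get ∘ Tuple.sort l.get) Finset.univ.val = (l : Multiset (Fin d))
      rw [← Multiset.map_map, Multiset.map_univ_val_equiv]
      simp [Fin.univ_val_map]
  have h1 := Fintype.card_le_of_surjective f hf
  rw [Sym.card_sym_eq_multichoose, Fintype.card_fin, Nat.multichoose_eq] at h1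
  have h2 : (d + p - 1).choose p = (p + (d - 1)).choose (d - 1) := by
    rw [show d + p - 1 = p + (d - 1) by omega, Nat.choose_symm_add]
  have h3 : p ^ (d - 1) ≤ (d - 1).factorial * (p + (d - 1)).choose (d - 1) := by
    rw [← Nat.ascFactorial_eq_factorial_mul_choose]
    exact (Nat.pow_le_pow_left (Nat.le_succ p) _).trans (Nat.pow_succ_le_ascFactorial _ _)
  rw [div_le_iff₀ (by positivity)]
  rw [h2] at h1
  have : p ^ (d - 1) ≤ Fintype.card (MonoTuple d p) * (d - 1).factorial :=
    h3.trans (by rw [mul_comm]; exact Nat.mul_le_mul_right _ h1)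
  exact_mod_cast this

end Tuples

/-! ### The injective norm and Banach's theorem for symmetric tensors. -/

section InjectiveNorm

variable {d p : ℕ}

/-- `pairing T` as a multilinear map. -/
def pairingMap (T : Tensor d p) :
    MultilinearMap ℂ (fun _ : Fin p => EuclideanSpace ℂ (Fin d)) ℂ :=
  ∑ i : Fin p → Fin d, (starRingEnd ℂ) (T i) •
    (MultilinearMap.mkPiAlgebra ℂ (Fin p) ℂ).compLinearMap
      (fun j => (EuclideanSpace.proj (i j) : EuclideanSpace ℂ (Fin d) →L[ℂ] ℂ).toLinearMap)

lemma pairingMap_apply (T : Tensor d p) (x : Fin p → EuclideanSpace ℂ (Fin d)) :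
    pairingMap T x = pairing T x := by
  simp [pairingMap, pairing]

lemma sum_norm_prod_sq (x : Fin p → EuclideanSpace ℂ (Fin d)) :
    ∑ i : Fin p → Fin d, ‖∏ j, x j (i j)‖ ^ 2 = ∏ j, ‖x j‖ ^ 2 := by
  simp_rw [EuclideanSpace.norm_sq_eq, norm_prod, ← Finset.prod_pow]
  rw [Finset.prod_univ_sum, Fintype.piFinset_univ]

/-- Cauchy-Schwarz against a product vector of norm one. This also bounds the set in `injNorm`, so
that its `sSup` is a genuine supremum. -/
lemma norm_pairing_le_hsNorm (T : Tensor d p) (x : Fin p → EuclideanSpace ℂ (Fin d))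
    (hx : ∀ j, ‖x j‖ = 1) : ‖pairing T x‖ ≤ hsNorm T := by
  have h1 : ‖pairing T x‖ ≤ ∑ i, ‖T i‖ * ‖∏ j, x j (i j)‖ := by
    refine (norm_sum_le _ _).trans_eq (Finset.sum_congr rfl fun i _ => ?_)
    rw [norm_mul, RCLike.norm_conj]
  have h2 := Finset.sum_mul_sq_le_sq_mul_sq Finset.univ (fun i => ‖T i‖)
    (fun i => ‖∏ j, x j (i j)‖)
  rw [sum_norm_prod_sq, Finset.prod_congr rfl fun j _ => by rw [hx j]] at h2
  refine h1.trans (Real.le_sqrt_of_sq_le ?_)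
  simpa using h2

lemma norm_pairing_le_injNorm (T : Tensor d p) (x : Fin p → EuclideanSpace ℂ (Fin d))
    (hx : ∀ j, ‖x j‖ = 1) : ‖pairing T x‖ ≤ injNorm T :=
  le_csSup ⟨hsNorm T, by rintro r ⟨y, hy, rfl⟩; exact norm_pairing_le_hsNorm T y hy⟩ ⟨x, hx, rfl⟩

lemma injNorm_nonneg (T : Tensor d p) : 0 ≤ injNorm T :=
  Real.sSup_nonneg (by rintro r ⟨x, -, rfl⟩; exact norm_nonneg _)

lemma injNorm_le_of_forall {T : Tensor d p} {C : ℝ} (hC : 0 ≤ C)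
    (h : ∀ x : Fin p → EuclideanSpace ℂ (Fin d), (∀ j, ‖x j‖ = 1) → ‖pairing T x‖ ≤ C) :
    injNorm T ≤ C :=
  Real.sSup_le (by rintro r ⟨x, hx, rfl⟩; exact h x hx) hC

lemma injNorm_le_hsNorm (T : Tensor d p) : injNorm T ≤ hsNorm T :=
  injNorm_le_of_forall (Real.sqrt_nonneg _) fun x hx => norm_pairing_le_hsNorm T x hx

lemma pairing_add (T S : Tensor d p) (x : Fin p → EuclideanSpace ℂ (Fin d)) :
    pairing (T + S) x = pairing T x + pairing S x := by
  simp [pairing, add_mul, Finset.sum_add_distrib]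

lemma injNorm_add_le (T S : Tensor d p) : injNorm (T + S) ≤ injNorm T + injNorm S :=
  injNorm_le_of_forall (add_nonneg (injNorm_nonneg _) (injNorm_nonneg _)) fun x hx => by
    rw [pairing_add]
    exact (norm_add_le _ _).trans
      (add_le_add (norm_pairing_le_injNorm T x hx) (norm_pairing_le_injNorm S x hx))

lemma hsNorm_le (T : Tensor d p) :
    hsNorm T ≤ Real.sqrt (Fintype.card (Fin p → Fin d)) * ‖T‖ := by
  rw [hsNorm, ← Real.sqrt_sq (norm_nonneg T), ← Real.sqrt_mul (Nat.cast_nonneg _)]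
  refine Real.sqrt_le_sqrt ?_
  calc ∑ i, ‖T i‖ ^ 2 ≤ ∑ _i : Fin p → Fin d, ‖T‖ ^ 2 :=
        Finset.sum_le_sum fun i _ => pow_le_pow_left₀ (norm_nonneg _) (norm_le_pi_norm T i) 2
    _ = _ := by simp

/-- Serves only to make the normalised injective norm measurable. -/
lemma continuous_injNorm : Continuous (injNorm : Tensor d p → ℝ) := by
  refine (LipschitzWith.of_le_add_mul (Real.toNNReal (Real.sqrt (Fintype.card (Fin p → Fin d))))
    fun T S => ?_).continuous
  rw [Real.coe_toNNReal _ (Real.sqrt_nonneg _), dist_eq_norm]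
  calc injNorm T = injNorm (S + (T - S)) := by congr 1; abel
    _ ≤ injNorm S + injNorm (T - S) := injNorm_add_le _ _
    _ ≤ _ := by gcongr; exact (injNorm_le_hsNorm _).trans (hsNorm_le _)

lemma measurable_injNorm_normalise :
    Measurable (fun T : Tensor d p => injNorm (normalise T)) := by
  refine continuous_injNorm.measurable.comp (measurable_pi_lambda _ fun i => ?_)
  unfold normalise hsNorm
  fun_prop

lemma hsNorm_nonneg (T : Tensor d p) : 0 ≤ hsNorm T := Real.sqrt_nonneg _

lemma injNorm_normalise (T : Tensor d p) : injNorm (normalise T) ≤ injNorm T / hsNorm T := by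
  refine injNorm_le_of_forall (div_nonneg (injNorm_nonneg _) (hsNorm_nonneg _)) fun x hx => ?_
  have : pairing (normalise T) x = pairing T x / (hsNorm T : ℂ) := by
    simp only [pairing, normalise, map_div₀, Complex.conj_ofReal, Finset.sum_div]
    exact Finset.sum_congr rfl fun i _ => by ring
  rw [this, norm_div, Complex.norm_real, Real.norm_of_nonneg (hsNorm_nonneg T)]
  exact div_le_div_of_nonneg_right (norm_pairing_le_injNorm T x hx) (hsNorm_nonneg T)

lemma injNorm_normalise_le_one (T : Tensor d p) : injNorm (normalise T) ≤ 1 :=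
  (injNorm_normalise T).trans (div_le_one_of_le₀ (injNorm_le_hsNorm T) (hsNorm_nonneg T))

lemma pairing_comp_perm {T : Tensor d p} (hT : IsSymmetric T) (σ : Equiv.Perm (Fin p))
    (x : Fin p → EuclideanSpace ℂ (Fin d)) : pairing T (x ∘ σ) = pairing T x := by
  unfold pairing
  refine Fintype.sum_equiv (σ.symm.arrowCongr (Equiv.refl (Fin d))).symm _ _ fun i => ?_
  have h : (σ.symm.arrowCongr (Equiv.refl (Fin d))).symm i = i ∘ σ.symm := by
    funext j; simp [Equiv.arrowCongr]
  rw [h, hT]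
  congr 1
  refine Fintype.prod_equiv σ _ _ fun j => ?_
  simp

lemma continuous_pairing (T : Tensor d p) :
    Continuous (fun x : Fin p → EuclideanSpace ℂ (Fin d) => pairing T x) := by
  unfold pairing
  fun_prop

/-- If a functional of norm at most `M` has modulus `M` at a unit vector `y`, it is a multiple of
the inner product with `y`. -/
lemma eq_mul_inner_of_norm_attained {E : Type*} [NormedAddCommGroup E] [InnerProductSpace ℂ E]
    [CompleteSpace E] (φ : E →L[ℂ] ℂ) {M : ℝ} (hM : ∀ z, ‖φ z‖ ≤ M * ‖z‖) (hM0 : 0 ≤ M) {y : E}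
    (hy : ‖y‖ = 1) (hφ : ‖φ y‖ = M) (z : E) : φ z = φ y * inner ℂ y z := by
  set c := (InnerProductSpace.toDual ℂ E).symm φ with hc
  have hφc : ∀ w, inner ℂ c w = φ w := fun w => InnerProductSpace.toDual_symm_apply
  have hcM : ‖c‖ ≤ M := by
    rw [hc, LinearIsometryEquiv.norm_map]
    exact φ.opNorm_le_bound hM0 hM
  -- Equality case of Cauchy-Schwarz: the Riesz vector `c` has norm at most `M`, and its component
  -- along `y` already has norm `M`.
  have h0 : c - (starRingEnd ℂ) (φ y) • y = 0 := by
    rw [← norm_eq_zero]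
    have : ‖c - (starRingEnd ℂ) (φ y) • y‖ ^ 2 = ‖c‖ ^ 2 - M ^ 2 := by
      rw [@norm_sub_sq ℂ, inner_smul_right, hφc, norm_smul, RCLike.norm_conj, hφ, hy]
      have h2 : (starRingEnd ℂ) (φ y) * φ y = ((M ^ 2 : ℝ) : ℂ) := by
        rw [mul_comm, Complex.mul_conj, Complex.normSq_eq_norm_sq, hφ]
      rw [h2]
      change ‖c‖ ^ 2 - 2 * ((M ^ 2 : ℝ) : ℂ).re + _ = _
      rw [Complex.ofReal_re]
      ring
    have h1 : ‖c‖ ^ 2 ≤ M ^ 2 := pow_le_pow_left₀ (norm_nonneg _) hcM 2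
    nlinarith [norm_nonneg (c - (starRingEnd ℂ) (φ y) • y)]
  rw [← hφc z, sub_eq_zero.1 h0, inner_smul_left]
  simp

lemma norm_pairing_le_prod (T : Tensor d p) (x : Fin p → EuclideanSpace ℂ (Fin d)) :
    ‖pairing T x‖ ≤ injNorm T * ∏ j, ‖x j‖ := by
  by_cases h : ∀ j, x j ≠ 0
  · have hx : x = fun j => ((‖x j‖ : ℝ) : ℂ) • (((‖x j‖⁻¹ : ℝ) : ℂ) • x j) := by
      funext j
      rw [smul_smul, ← Complex.ofReal_mul, mul_inv_cancel₀ (norm_ne_zero_iff.2 (h j))]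
      simp
    have h1 : pairing T x = (∏ j, ((‖x j‖ : ℝ) : ℂ)) *
        pairing T (fun j => ((‖x j‖⁻¹ : ℝ) : ℂ) • x j) := by
      conv_lhs => rw [hx, ← pairingMap_apply, MultilinearMap.map_smul_univ, pairingMap_apply]
      rfl
    rw [h1, norm_mul, mul_comm, norm_prod]
    simp only [Complex.norm_real, norm_norm]
    refine mul_le_mul_of_nonneg_right (norm_pairing_le_injNorm T _ fun j => ?_)
      (Finset.prod_nonneg fun _ _ => norm_nonneg _)
    rw [norm_smul, Complex.norm_real, norm_inv, norm_norm,
      inv_mul_cancel₀ (norm_ne_zero_iff.2 (h j))]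
  · push Not at h
    obtain ⟨j, hj⟩ := h
    rw [← pairingMap_apply, MultilinearMap.map_coord_zero _ j hj, norm_zero]
    exact mul_nonneg (injNorm_nonneg _) (Finset.prod_nonneg fun _ _ => norm_nonneg _)

/-- The tuples of unit vectors at which the injective norm is attained. -/
def maximizers (T : Tensor d p) : Set (Fin p → EuclideanSpace ℂ (Fin d)) :=
  {x | (∀ j, ‖x j‖ = 1) ∧ ‖pairing T x‖ = injNorm T}

lemma isCompact_unitTuples :
    IsCompact {x : Fin p → EuclideanSpace ℂ (Fin d) | ∀ j, ‖x j‖ = 1} := by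
  have h : {x : Fin p → EuclideanSpace ℂ (Fin d) | ∀ j, ‖x j‖ = 1} =
      Set.pi Set.univ (fun _ => Metric.sphere 0 1) := by
    ext x; simp
  rw [h]
  exact isCompact_univ_pi fun _ => isCompact_sphere _ _

lemma isCompact_maximizers (T : Tensor d p) : IsCompact (maximizers T) := by
  have : maximizers T = {x | ∀ j, ‖x j‖ = 1} ∩ {x | ‖pairing T x‖ = injNorm T} := rfl
  rw [this]
  exact isCompact_unitTuples.inter_right
    (isClosed_eq (continuous_pairing T).norm continuous_const)

lemma maximizers_nonempty (hd : 1 ≤ d) (T : Tensor d p) : (maximizers T).Nonempty := by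
  have hne : {x : Fin p → EuclideanSpace ℂ (Fin d) | ∀ j, ‖x j‖ = 1}.Nonempty :=
    ⟨fun _ => EuclideanSpace.single ⟨0, hd⟩ 1, fun _ => by simp⟩
  obtain ⟨x, hx, hmax⟩ := isCompact_unitTuples.exists_isMaxOn hne
    (continuous_pairing T).norm.continuousOn
  exact ⟨x, hx, le_antisymm (norm_pairing_le_injNorm T x hx)
    (injNorm_le_of_forall (norm_nonneg _) fun y hy => hmax hy)⟩

/-- Two entries of a maximizing tuple can both be replaced by their normalised sum. -/
lemma update_update_mem_maximizers {T : Tensor d p} (hT : IsSymmetric T)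
    {x : Fin p → EuclideanSpace ℂ (Fin d)} (hx : x ∈ maximizers T) {j k : Fin p} (hjk : j ≠ k)
    (hne : x j + x k ≠ 0) :
    Function.update (Function.update x j (((‖x j + x k‖⁻¹ : ℝ) : ℂ) • (x j + x k))) k
      (((‖x j + x k‖⁻¹ : ℝ) : ℂ) • (x j + x k)) ∈ maximizers T := by
  obtain ⟨hx1, hxM⟩ := hx
  set r := ‖x j + x k‖ with hr
  have hr0 : r ≠ 0 := norm_ne_zero_iff.2 hne
  set A : EuclideanSpace ℂ (Fin d) → EuclideanSpace ℂ (Fin d) → ℂ := fun a b =>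
    pairing T (Function.update (Function.update x j a) k b) with hA
  have hA' : ∀ a b, A a b = pairingMap T (Function.update (Function.update x j a) k b) :=
    fun a b => (pairingMap_apply _ _).symm
  have hAc : ∀ a b, A a b = pairingMap T (Function.update (Function.update x k b) j a) :=
    fun a b => by rw [hA', Function.update_comm hjk]
  have hsymm : ∀ a b, A a b = A b a := by
    intro a b
    simp only [hA]
    rw [← pairing_comp_perm hT (Equiv.swap j k)]
    congr 1
    funext l
    simp only [Function.comp_apply, Function.update_apply]
    rcases eq_or_ne l j with rfl | hlj
    · simp [hjk]
    · rcases eq_or_ne l k with rfl | hlk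
      · simp [hjk]
      · rw [Equiv.swap_apply_of_ne_of_ne hlj hlk]; simp [hlj, hlk]
  have hadd : ∀ a b b', A a (b + b') = A a b + A a b' := fun a b b' => by
    simp only [hA', MultilinearMap.map_update_add]
  have hsmul : ∀ (c : ℂ) a b, A a (c • b) = c * A a b := fun c a b => by
    simp only [hA', MultilinearMap.map_update_smul, smul_eq_mul]
  have hbound : ∀ a b, ‖a‖ = 1 → ‖A a b‖ ≤ injNorm T * ‖b‖ := by
    intro a b ha
    refine (norm_pairing_le_prod T _).trans_eq ?_
    congr 1
    rw [Finset.prod_eq_single k]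
    · simp
    · intro l _ hl
      rw [Function.update_of_ne hl]
      rcases eq_or_ne l j with rfl | hlj
      · simpa using ha
      · rw [Function.update_of_ne hlj, hx1]
    · simp
  have hself : A (x j) (x k) = pairing T x := by simp [hA]
  let φ : EuclideanSpace ℂ (Fin d) → (EuclideanSpace ℂ (Fin d) →L[ℂ] ℂ) := fun a =>
    LinearMap.toContinuousLinearMap
      { toFun := A a, map_add' := hadd a, map_smul' := fun c b => by simp [hsmul] }
  have hφ : ∀ a b, φ a b = A a b := fun a b => rfl
  -- With the other slots frozen, the functional in one slot attains its norm at the vector of a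
  -- maximizing tuple, so it is an inner product. Adding the two functionals evaluates the form at
  -- the sum as `‖x j + x k‖²` times the maximum.
  have hj : ∀ z, A (x j) z = pairing T x * inner ℂ (x k) z := fun z => by
    have := eq_mul_inner_of_norm_attained (φ (x j)) (fun z => hbound _ z (hx1 j))
      (injNorm_nonneg T) (hx1 k) (by rw [hφ, hself, hxM]) z
    rwa [hφ, hφ, hself] at this
  have hk : ∀ z, A (x k) z = pairing T x * inner ℂ (x j) z := fun z => by
    have := eq_mul_inner_of_norm_attained (φ (x k)) (fun z => hbound _ z (hx1 k))
      (injNorm_nonneg T) (hx1 j) (by rw [hφ, hsymm, hself, hxM]) z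
    rwa [hφ, hφ, hsymm (x k) (x j), hself] at this
  have hsum : A (x j + x k) (x j + x k) = pairing T x * ((r : ℂ) ^ 2) := by
    have h1 : A (x j + x k) (x j + x k) = A (x j) (x j + x k) + A (x k) (x j + x k) := by
      rw [hadd, hsymm _ (x j), hsymm _ (x k)]
    rw [h1, hj, hk, ← mul_add, add_comm, ← inner_add_left, inner_self_eq_norm_sq_to_K]
    rfl
  refine ⟨fun l => ?_, ?_⟩
  · have hu : ‖((r⁻¹ : ℝ) : ℂ) • (x j + x k)‖ = 1 := by
      rw [norm_smul, Complex.norm_real, norm_inv, hr, norm_norm, inv_mul_cancel₀ hr0]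
    rcases eq_or_ne l k with rfl | hlk
    · simpa using hu
    · rw [Function.update_of_ne hlk]
      rcases eq_or_ne l j with rfl | hlj
      · simpa using hu
      · rw [Function.update_of_ne hlj, hx1]
  · change ‖A _ _‖ = _
    rw [hsmul, hsymm, hsmul, hsum, norm_mul, norm_mul, norm_mul, hxM]
    simp only [Complex.norm_real, norm_inv, norm_pow, Real.norm_eq_abs]
    rw [sq, mul_comm (injNorm T)]
    have : |r| ≠ 0 := abs_ne_zero.2 hr0
    field_simp

lemma update_neg_mem_maximizers {T : Tensor d p} {x : Fin p → EuclideanSpace ℂ (Fin d)}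
    (hx : x ∈ maximizers T) (k : Fin p) : Function.update x k (-x k) ∈ maximizers T := by
  obtain ⟨hx1, hxM⟩ := hx
  refine ⟨fun l => ?_, ?_⟩
  · rcases eq_or_ne l k with rfl | hlk
    · simpa using hx1 l
    · rw [Function.update_of_ne hlk, hx1]
  · rw [← pairingMap_apply, MultilinearMap.map_update_neg, Function.update_eq_self, norm_neg,
      pairingMap_apply, hxM]

/-- **Banach's theorem**: the injective norm of a symmetric tensor is attained at a tuple of equal
vectors. -/
theorem exists_injNorm_eq {T : Tensor d p} (hd : 1 ≤ d) (hp : 1 ≤ p) (hT : IsSymmetric T) :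
    ∃ x : EuclideanSpace ℂ (Fin d), ‖x‖ = 1 ∧ ‖pairing T (fun _ => x)‖ = injNorm T := by
  obtain ⟨x₀, hx₀⟩ := maximizers_nonempty hd T
  set j₀ : Fin p := ⟨0, hp⟩
  set v := x₀ j₀ with hv
  -- Among all maximizing tuples, one that maximizes the sum of `g` will be shown to be constant.
  set g : EuclideanSpace ℂ (Fin d) → ℝ := fun a => (inner ℂ v a : ℂ).re with hg
  have hgadd : ∀ a b, g (a + b) = g a + g b := fun a b => by simp [hg]
  have hgneg : ∀ a, g (-a) = -g a := fun a => by simp [hg]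
  have hgsmul : ∀ (r : ℝ) a, g ((r : ℂ) • a) = r * g a := fun r a => by
    simp [hg]
  have hgc : Continuous g := by simp only [hg]; fun_prop
  have hgv : g v = 1 := by simp [hg, inner_self_eq_norm_sq_to_K, hv, hx₀.1 j₀]
  have hupd : ∀ (y : Fin p → EuclideanSpace ℂ (Fin d)) k a,
      ∑ j, g (Function.update y k a j) = ∑ j, g (y j) - g (y k) + g a := by
    intro y k a
    rw [← Finset.add_sum_erase _ _ (Finset.mem_univ k),
      ← Finset.add_sum_erase _ (fun j => g (y j)) (Finset.mem_univ k)]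
    have : ∑ j ∈ Finset.univ.erase k, g (Function.update y k a j) =
        ∑ j ∈ Finset.univ.erase k, g (y j) :=
      Finset.sum_congr rfl fun j hj => by rw [Function.update_of_ne (Finset.ne_of_mem_erase hj)]
    rw [this]; simp; ring
  obtain ⟨x, hx, hmax⟩ := (isCompact_maximizers T).exists_isMaxOn ⟨x₀, hx₀⟩
    (f := fun y => ∑ j, g (y j)) (by fun_prop)
  have hnn : ∀ y ∈ maximizers T, (∀ z ∈ maximizers T, ∑ j, g (z j) ≤ ∑ j, g (y j)) →
      ∀ k, 0 ≤ g (y k) := by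
    intro y hy hm k
    have := hm _ (update_neg_mem_maximizers hy k)
    rw [hupd, hgneg] at this
    linarith
  have hxnn := hnn x hx fun z hz => hmax hz
  -- Flipping signs in `x₀` makes every `g` nonnegative without touching slot `j₀`, where `g = 1`.
  have hpos : 0 < ∑ j, g (x j) := by
    have hflip : ∀ s : Finset (Fin p), ∃ y ∈ maximizers T, y j₀ = x₀ j₀ ∧
        ∀ k ∈ s, 0 ≤ g (y k) := by
      classical
      intro s
      induction s using Finset.induction_on with
      | empty => exact ⟨x₀, hx₀, rfl, by simp⟩
      | insert k s hk ih =>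
        obtain ⟨y, hy, hy0, hys⟩ := ih
        by_cases h : 0 ≤ g (y k)
        · refine ⟨y, hy, hy0, fun l hl => ?_⟩
          rcases Finset.mem_insert.1 hl with rfl | hl
          · exact h
          · exact hys l hl
        · have hkj : j₀ ≠ k := by
            rintro rfl
            rw [hy0, ← hv, hgv] at h
            norm_num at h
          refine ⟨_, update_neg_mem_maximizers hy k, by
            rw [Function.update_of_ne hkj, hy0], fun l hl => ?_⟩
          rcases eq_or_ne l k with rfl | hlk
          · rw [Function.update_self, hgneg]; linarith
          · rw [Function.update_of_ne hlk]
            exact hys l ((Finset.mem_insert.1 hl).resolve_left hlk)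
    obtain ⟨y, hy, hy0, hys⟩ := hflip Finset.univ
    have h1 : g (y j₀) ≤ ∑ j, g (y j) :=
      Finset.single_le_sum (f := fun j => g (y j)) (fun j hj => hys j hj) (Finset.mem_univ j₀)
    have h2 : ∑ j, g (y j) ≤ ∑ j, g (x j) := hmax hy
    rw [hy0, ← hv, hgv] at h1
    linarith
  obtain ⟨j, hj⟩ : ∃ j, 0 < g (x j) := by
    by_contra! h
    exact absurd hpos (not_lt.2 (Finset.sum_nonpos fun j _ => h j))
  refine ⟨x j, hx.1 j, ?_⟩
  -- If two entries differed, merging them would replace `g (x j + x k) > 0` by `2/‖x j + x k‖`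
  -- times itself. Strict convexity makes this factor exceed one, contradicting maximality.
  have hall : (fun _ => x j) = x := by
    funext k
    by_contra hne
    have hjk : j ≠ k := by rintro rfl; exact hne rfl
    have hs : 0 < g (x j + x k) := by rw [hgadd]; linarith [hxnn k]
    have hs0 : x j + x k ≠ 0 := by
      intro h0
      rw [h0] at hs
      simp [hg] at hs
    have hr2 : ‖x j + x k‖ < 2 := by
      have := norm_add_lt_of_not_sameRay (E := EuclideanSpace ℂ (Fin d))
        (x := x j) (y := x k) (fun hsr => hne (hsr.eq_of_norm_eq (by rw [hx.1, hx.1])))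
      rw [hx.1, hx.1] at this
      linarith
    have hm : ∑ l, g (Function.update (Function.update x j _) k _ l) ≤ ∑ l, g (x l) :=
      hmax (update_update_mem_maximizers hT hx hjk hs0)
    rw [hupd, hupd, hgsmul, Function.update_of_ne hjk.symm] at hm
    have hr0 : 0 < ‖x j + x k‖ := norm_pos_iff.2 hs0
    have hinv : (2 : ℝ) * ‖x j + x k‖⁻¹ > 1 := by
      rw [gt_iff_lt, ← div_eq_mul_inv, lt_div_iff₀ hr0]; linarith
    have h3 := hgadd (x j) (x k)
    nlinarith
  rw [hall]
  exact hx.2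

end InjectiveNorm

/-! ### Discretisation of the maximum over projective space. -/

section Net

variable {d p : ℕ}

/-- The homogeneous polynomial `x ↦ ⟨T, x ⊗ ⋯ ⊗ x⟩`. -/
def diagPairing (T : Tensor d p) (x : EuclideanSpace ℂ (Fin d)) : ℂ := pairing T (fun _ => x)

lemma diagPairing_smul (T : Tensor d p) (c : ℂ) (x : EuclideanSpace ℂ (Fin d)) :
    diagPairing T (c • x) = c ^ p * diagPairing T x := by
  simp only [diagPairing, ← pairingMap_apply]
  rw [MultilinearMap.map_smul_univ (pairingMap T) (fun _ => c) (fun _ => x)]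
  simp

lemma norm_diagPairing_le (T : Tensor d p) (x : EuclideanSpace ℂ (Fin d)) :
    ‖diagPairing T x‖ ≤ injNorm T * ‖x‖ ^ p := by
  simpa [diagPairing] using norm_pairing_le_prod T (fun _ => x)

lemma differentiable_diagPairing_line (T : Tensor d p) (x w : EuclideanSpace ℂ (Fin d)) :
    Differentiable ℂ (fun t : ℂ => diagPairing T (x + t • w)) := by
  unfold diagPairing pairing
  simp only [PiLp.add_apply, PiLp.smul_apply, smul_eq_mul]
  fun_prop

lemma norm_add_sq_of_orthogonal {E : Type*} [NormedAddCommGroup E] [InnerProductSpace ℂ E]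
    {x w : E} (hx : ‖x‖ = 1) (hw : inner ℂ x w = 0) (t : ℂ) :
    ‖x + t • w‖ ^ 2 = 1 + ‖t‖ ^ 2 * ‖w‖ ^ 2 := by
  rw [@norm_add_sq ℂ, inner_smul_right, hw, norm_smul, hx]
  simp
  ring

/-- Orthogonality kills the first-order term, so the norm grows like `(1 + u)^p ≤ e^(pu)` with `u`
quadratic in the displacement. Hence the natural length scale is `1/√p`. -/
lemma norm_add_pow_le_exp {E : Type*} [NormedAddCommGroup E] [InnerProductSpace ℂ E]
    {x w : E} (hx : ‖x‖ = 1) (hw : inner ℂ x w = 0) (t : ℂ) (p : ℕ) {b : ℝ}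
    (hb : (p : ℝ) * (‖t‖ ^ 2 * ‖w‖ ^ 2) ≤ b) : ‖x + t • w‖ ^ p ≤ Real.exp b := by
  have h1 : ‖x + t • w‖ ≤ ‖x + t • w‖ ^ 2 := by
    have : 1 ≤ ‖x + t • w‖ ^ 2 := by
      rw [norm_add_sq_of_orthogonal hx hw]
      nlinarith [sq_nonneg (‖t‖ * ‖w‖)]
    have : 1 ≤ ‖x + t • w‖ := by
      by_contra! h
      nlinarith [norm_nonneg (x + t • w)]
    nlinarith
  calc ‖x + t • w‖ ^ p ≤ (‖x + t • w‖ ^ 2) ^ p := pow_le_pow_left₀ (norm_nonneg _) h1 p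
    _ ≤ (Real.exp (‖t‖ ^ 2 * ‖w‖ ^ 2)) ^ p := by
        rw [norm_add_sq_of_orthogonal hx hw]
        gcongr
        rw [add_comm]; exact Real.add_one_le_exp _
    _ = Real.exp (p * (‖t‖ ^ 2 * ‖w‖ ^ 2)) := by rw [← Real.exp_nat_mul]
    _ ≤ _ := Real.exp_le_exp.2 hb

/-- At orthogonal distance `O(s / √p)` from a maximum of the polynomial, its modulus is still
nearly maximal. This is the Schwarz lemma on a complex line. -/
lemma le_norm_diagPairing_add (T : Tensor d p) {x w : EuclideanSpace ℂ (Fin d)}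
    (hx : ‖x‖ = 1) (hmax : ‖diagPairing T x‖ = injNorm T) (hw : inner ℂ x w = 0) {s : ℝ}
    (hs0 : 0 < s) (hs1 : s < 1) (hpw : (p : ℝ) * ‖w‖ ^ 2 ≤ s ^ 2) :
    (1 - 4 * s) * injNorm T ≤ ‖diagPairing T (x + w)‖ := by
  set M := injNorm T with hM
  rcases (injNorm_nonneg T).eq_or_lt with h0 | hpos
  · rw [hM, ← h0]; simp
  set h : ℂ → ℂ := fun t => diagPairing T (x + t • w) with hh
  have hh0 : h 0 = diagPairing T x := by simp [hh]
  have hh1 : h 1 = diagPairing T (x + w) := by simp [hh]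
  -- For `|t| < 1/s` the growth bound gives `|h| ≤ eM`, so `h` stays within `(e + 1)M ≤ 4M` of `h
  -- 0`. The Schwarz lemma at `t = 1` then loses at most `4sM`.
  have hmaps : Set.MapsTo h (Metric.ball 0 (1 / s)) (Metric.closedBall (h 0) (4 * M)) := by
    intro t ht
    rw [mem_ball_zero_iff, lt_div_iff₀ hs0] at ht
    rw [mem_closedBall_iff_norm]
    have hb : (p : ℝ) * (‖t‖ ^ 2 * ‖w‖ ^ 2) ≤ 1 := by
      calc (p : ℝ) * (‖t‖ ^ 2 * ‖w‖ ^ 2) = ‖t‖ ^ 2 * (p * ‖w‖ ^ 2) := by ring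
        _ ≤ ‖t‖ ^ 2 * s ^ 2 := by gcongr
        _ = (‖t‖ * s) ^ 2 := by ring
        _ ≤ 1 := by
          have : 0 ≤ ‖t‖ * s := by positivity
          nlinarith
    have h1 : ‖h t‖ ≤ M * Real.exp 1 :=
      (norm_diagPairing_le T _).trans
        (mul_le_mul_of_nonneg_left (norm_add_pow_le_exp hx hw t p hb) hpos.le)
    have h2 := Real.exp_one_lt_d9
    have h3 : ‖h 0‖ = M := by rw [hh0, hmax]
    have := norm_sub_le (h t) (h 0)
    nlinarith
  have hsw := Complex.dist_le_div_mul_dist_of_mapsTo_ball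
    (differentiable_diagPairing_line T x w).differentiableOn hmaps
    (z := 1) (by rw [mem_ball_zero_iff, norm_one, lt_div_iff₀ hs0]; linarith)
  change dist (h 1) (h 0) ≤ _ at hsw
  rw [dist_eq_norm, dist_zero_right, norm_one, mul_one, div_div_eq_mul_div, div_one, hh1, hh0,
    norm_sub_rev] at hsw
  have := norm_sub_norm_le (diagPairing T x) (diagPairing T (x + w))
  rw [hmax] at this
  linarith

/-- A vector close to a multiple of a maximizer almost attains the injective norm. -/
lemma le_norm_diagPairing_of_near (T : Tensor d p) {x Z : EuclideanSpace ℂ (Fin d)} {c : ℂ}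
    (hx : ‖x‖ = 1) (hmax : ‖diagPairing T x‖ = injNorm T) (hc : 1 ≤ ‖c‖) {δ s : ℝ}
    (hδ : δ ≤ 1 / 2) (hZ : ‖Z - c • x‖ ≤ δ) (hs0 : 0 < s) (hs : s ≤ 1 / 8)
    (hps : (p : ℝ) * (2 * δ) ^ 2 ≤ s ^ 2) :
    (1 - 5 * s) * injNorm T * ‖Z‖ ^ p ≤ ‖diagPairing T Z‖ := by
  -- Project `Z` onto `x` to write `Z = b(x + w)` with `w` orthogonal to `x`; as `|b| ≥ 1/2`,
  -- dividing by `b` at most doubles the error `δ`.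
  set b : ℂ := inner ℂ x Z with hb
  have hxx : inner ℂ x x = (1 : ℂ) := by simp [inner_self_eq_norm_sq_to_K, hx]
  have horth : inner ℂ x (Z - b • x) = 0 := by
    rw [inner_sub_right, inner_smul_right, hxx, mul_one, sub_self]
  have hpy : ‖Z - c • x‖ ^ 2 = ‖Z - b • x‖ ^ 2 + ‖b - c‖ ^ 2 := by
    have : Z - c • x = (Z - b • x) + (b - c) • x := by rw [sub_smul]; abel
    rw [this, @norm_add_sq ℂ, inner_smul_right, ← inner_conj_symm, horth, norm_smul, hx]
    simp
  have hδ0 : 0 ≤ δ := (norm_nonneg _).trans hZ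
  have hZ2 : ‖Z - c • x‖ ^ 2 ≤ δ ^ 2 := pow_le_pow_left₀ (norm_nonneg _) hZ 2
  have hbc : ‖b - c‖ ≤ δ := abs_le_of_sq_le_sq' (by nlinarith [sq_nonneg ‖Z - b • x‖]) hδ0 |>.2
  have hW : ‖Z - b • x‖ ≤ δ := abs_le_of_sq_le_sq' (by nlinarith [sq_nonneg ‖b - c‖]) hδ0 |>.2
  have hb2 : 1 / 2 ≤ ‖b‖ := by
    have := norm_sub_norm_le c b
    rw [norm_sub_rev] at this
    linarith
  have hb0 : b ≠ 0 := by rw [← norm_pos_iff]; linarith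
  set w : EuclideanSpace ℂ (Fin d) := b⁻¹ • (Z - b • x) with hw
  have hworth : inner ℂ x w = 0 := by rw [hw, inner_smul_right, horth, mul_zero]
  have hwn : ‖w‖ ≤ 2 * δ := by
    rw [hw, norm_smul, norm_inv, inv_mul_le_iff₀ (by linarith)]
    nlinarith
  have hZw : Z = b • (x + w) := by
    rw [hw, smul_add, smul_smul, mul_inv_cancel₀ hb0, one_smul]; abel
  have hpw : (p : ℝ) * ‖w‖ ^ 2 ≤ s ^ 2 := le_trans (by gcongr) hps
  have hlow := le_norm_diagPairing_add T hx hmax hworth hs0 (by linarith) hpw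
  have hup : ‖x + w‖ ^ p ≤ Real.exp (s ^ 2) := by
    have := norm_add_pow_le_exp hx hworth 1 p (b := s ^ 2) (by simpa using hpw)
    simpa using this
  have hM := injNorm_nonneg T
  -- The Schwarz lemma costs `4s`; the fifth `s` pays for `‖x + w‖ ^ p ≤ exp(s²)`.
  have hexp : (1 - 5 * s) * Real.exp (s ^ 2) ≤ 1 - 4 * s := by
    have h1 : 1 - s ^ 2 ≤ Real.exp (-(s ^ 2)) := by
      have := Real.add_one_le_exp (-(s ^ 2)); linarith
    have h2 : Real.exp (-(s ^ 2)) * Real.exp (s ^ 2) = 1 := by rw [← Real.exp_add]; simp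
    have h3 : 1 - 5 * s ≤ (1 - 4 * s) * Real.exp (-(s ^ 2)) := by nlinarith
    calc (1 - 5 * s) * Real.exp (s ^ 2) ≤ (1 - 4 * s) * Real.exp (-(s ^ 2)) * Real.exp (s ^ 2) := by
          gcongr
      _ = 1 - 4 * s := by rw [mul_assoc, h2, mul_one]
  rw [hZw, diagPairing_smul, norm_mul, norm_smul, mul_pow, norm_pow]
  calc (1 - 5 * s) * injNorm T * (‖b‖ ^ p * ‖x + w‖ ^ p)
      ≤ (1 - 5 * s) * injNorm T * (‖b‖ ^ p * Real.exp (s ^ 2)) := by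
        have : 0 ≤ 1 - 5 * s := by linarith
        gcongr
    _ = ‖b‖ ^ p * (((1 - 5 * s) * Real.exp (s ^ 2)) * injNorm T) := by ring
    _ ≤ ‖b‖ ^ p * ((1 - 4 * s) * injNorm T) := by gcongr
    _ ≤ _ := by gcongr

/-- Indices of the net: a distinguished coordinate and a grid point in each other coordinate. -/
abbrev NetIndex (d m : ℕ) : Type := (j : Fin d) × ({l : Fin d // l ≠ j} → Fin m × Fin m)

/-- The grid `-1 + 2a/m`, `a < m`, in `[-1, 1]`. -/
def gridPoint {m : ℕ} (a : Fin m) : ℝ := -1 + 2 * (a : ℝ) / m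

/-- The net in the affine charts `x_j = 1` of projective space. -/
def netVec {m : ℕ} (q : NetIndex d m) : EuclideanSpace ℂ (Fin d) :=
  WithLp.toLp 2 fun l => if h : l = q.1 then 1 else
    ⟨gridPoint (q.2 ⟨l, h⟩).1, gridPoint (q.2 ⟨l, h⟩).2⟩

/-- The net in the unit sphere. -/
def netUnit {m : ℕ} (q : NetIndex d m) : EuclideanSpace ℂ (Fin d) :=
  ((‖netVec q‖⁻¹ : ℝ) : ℂ) • netVec q

lemma card_netIndex (d m : ℕ) : Fintype.card (NetIndex d m) = d * (m * m) ^ (d - 1) := by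
  simp [Fintype.card_subtype_compl]

lemma exists_gridPoint {m : ℕ} (hm : 1 ≤ m) {t : ℝ} (h0 : -1 ≤ t) (h1 : t ≤ 1) :
    ∃ a : Fin m, |t - gridPoint a| ≤ 2 / m := by
  have hm0 : (0 : ℝ) < m := by exact_mod_cast hm
  set s : ℝ := (t + 1) * m / 2 with hs
  have hs0 : 0 ≤ s := by
    have : 0 ≤ t + 1 := by linarith
    positivity
  have hsm : s ≤ m := by rw [hs]; nlinarith
  have key : ∀ a : Fin m, |s - a| ≤ 1 → |t - gridPoint a| ≤ 2 / m := by
    intro a ha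
    have : t - gridPoint a = (s - a) * (2 / m) := by
      rw [gridPoint, hs]; field_simp; ring
    rw [this, abs_mul, abs_of_pos (by positivity : (0 : ℝ) < 2 / m)]
    exact mul_le_of_le_one_left (by positivity) ha
  by_cases h : s < m
  · refine ⟨⟨⌊s⌋₊, (Nat.floor_lt hs0).2 h⟩, key _ ?_⟩
    have h2 := Nat.floor_le hs0
    have h3 := Nat.lt_floor_add_one s
    rw [abs_le]
    constructor <;> simp only <;> linarith
  -- At `t = 1` the floor would be `m`, outside the grid; the last grid point is still at distance
  -- `2/m`.
  · refine ⟨⟨m - 1, by omega⟩, key _ ?_⟩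
    have : s = m := le_antisymm hsm (not_lt.1 h)
    simp [this, Nat.cast_sub hm]

lemma one_le_norm_netVec {m : ℕ} (q : NetIndex d m) : 1 ≤ ‖netVec q‖ := by
  have := PiLp.norm_apply_le (netVec q) q.1
  simpa [netVec] using this

lemma norm_netUnit {m : ℕ} (q : NetIndex d m) : ‖netUnit q‖ = 1 := by
  have : ‖netVec q‖ ≠ 0 := by linarith [one_le_norm_netVec q]
  rw [netUnit, norm_smul, Complex.norm_real, norm_inv, norm_norm, inv_mul_cancel₀ this]

/-- Dividing by the largest coordinate puts the others in the unit disc, which the grid covers. Real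
and imaginary errors of `2/m` each give `4/m` per coordinate. -/
lemma exists_netVec_near {m : ℕ} (hm : 1 ≤ m) (hd : 1 ≤ d) {x : EuclideanSpace ℂ (Fin d)}
    (hx : ‖x‖ = 1) :
    ∃ (q : NetIndex d m) (c : ℂ), 1 ≤ ‖c‖ ∧ ‖netVec q - c • x‖ ≤ 4 * Real.sqrt d / m := by
  have : Nonempty (Fin d) := ⟨⟨0, hd⟩⟩
  have hm0 : (0 : ℝ) < m := by exact_mod_cast hm
  obtain ⟨j, hj⟩ := Finite.exists_max (fun l => ‖x l‖)
  have hxj : x j ≠ 0 := by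
    intro h0
    have : x = 0 := by
      ext l
      have := hj l
      rw [h0, norm_zero] at this
      simpa using this
    rw [this, norm_zero] at hx
    norm_num at hx
  have hle : ∀ l, ‖(x j)⁻¹ * x l‖ ≤ 1 := fun l => by
    rw [norm_mul, norm_inv, inv_mul_le_iff₀ (norm_pos_iff.2 hxj), mul_one]
    exact hj l
  have hre : ∀ l, ∃ a : Fin m, |((x j)⁻¹ * x l).re - gridPoint a| ≤ 2 / m := fun l => by
    have := abs_le.1 ((Complex.abs_re_le_norm _).trans (hle l))
    exact exists_gridPoint hm this.1 this.2
  have him : ∀ l, ∃ a : Fin m, |((x j)⁻¹ * x l).im - gridPoint a| ≤ 2 / m := fun l => by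
    have := abs_le.1 ((Complex.abs_im_le_norm _).trans (hle l))
    exact exists_gridPoint hm this.1 this.2
  choose a ha using hre
  choose b hb using him
  refine ⟨⟨j, fun l => (a l, b l)⟩, (x j)⁻¹, ?_, ?_⟩
  · rw [norm_inv]
    refine (one_le_inv₀ (norm_pos_iff.2 hxj)).2 ?_
    rw [← hx]
    exact PiLp.norm_apply_le x j
  · have hcoord : ∀ l, ‖(netVec (⟨j, fun l => (a l, b l)⟩ : NetIndex d m) - (x j)⁻¹ • x) l‖
        ≤ 4 / m := by
      intro l
      by_cases hl : l = j
      · subst hl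
        simp [netVec, hxj]
        positivity
      · simp only [netVec, PiLp.sub_apply, PiLp.smul_apply, smul_eq_mul, hl, dite_false]
        refine (Complex.norm_le_abs_re_add_abs_im _).trans ?_
        rw [Complex.sub_re, Complex.sub_im, abs_sub_comm, abs_sub_comm (gridPoint _)]
        have := add_le_add (ha l) (hb l)
        refine this.trans_eq ?_
        ring
    rw [EuclideanSpace.norm_eq]
    calc Real.sqrt (∑ l, ‖(netVec (⟨j, fun l => (a l, b l)⟩ : NetIndex d m) - (x j)⁻¹ • x) l‖ ^ 2)
        ≤ Real.sqrt (∑ _l : Fin d, (4 / (m : ℝ)) ^ 2) :=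
          Real.sqrt_le_sqrt (Finset.sum_le_sum fun l _ =>
            pow_le_pow_left₀ (norm_nonneg _) (hcoord l) 2)
      _ = 4 * Real.sqrt d / m := by
          rw [Finset.sum_const, Finset.card_univ, Fintype.card_fin, nsmul_eq_mul,
            Real.sqrt_mul (Nat.cast_nonneg _), Real.sqrt_sq (by positivity)]
          ring

/-- The injective norm of a symmetric tensor is almost attained on the net. -/
theorem exists_netUnit_le {m : ℕ} (hm : 1 ≤ m) (hd : 1 ≤ d) (hp : 1 ≤ p) {s : ℝ} (hs0 : 0 < s)
    (hs : s ≤ 1 / 8) (hms : 64 * (d : ℝ) * p ≤ s ^ 2 * (m : ℝ) ^ 2) {T : Tensor d p}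
    (hT : IsSymmetric T) :
    ∃ q : NetIndex d m, (1 - 5 * s) * injNorm T ≤ ‖diagPairing T (netUnit q)‖ := by
  have hm0 : (0 : ℝ) < m := by exact_mod_cast hm
  obtain ⟨x, hx, hmax⟩ := exists_injNorm_eq hd hp hT
  obtain ⟨q, c, hc, hq⟩ := exists_netVec_near (m := m) hm hd hx
  have hps : (p : ℝ) * (2 * (4 * Real.sqrt d / m)) ^ 2 ≤ s ^ 2 := by
    have : (p : ℝ) * (2 * (4 * Real.sqrt d / m)) ^ 2 = 64 * (d : ℝ) * p / (m : ℝ) ^ 2 := by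
      rw [mul_pow, div_pow, mul_pow, Real.sq_sqrt (Nat.cast_nonneg _)]
      ring
    rw [this, div_le_iff₀ (by positivity)]
    exact hms
  have hδ : 4 * Real.sqrt d / m ≤ 1 / 2 := by
    have h1 : (1 : ℝ) ≤ p := by exact_mod_cast hp
    have h2 : 0 ≤ 4 * Real.sqrt d / m := by positivity
    nlinarith [sq_nonneg (2 * (4 * Real.sqrt d / m))]
  have := le_norm_diagPairing_of_near T hx hmax hc hδ hq hs0 hs hps
  refine ⟨q, ?_⟩
  have hpos : 0 < ‖netVec q‖ := by linarith [one_le_norm_netVec q]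
  rw [netUnit, diagPairing_smul, norm_mul, norm_pow, Complex.norm_real, norm_inv, norm_norm,
    inv_pow, ← div_eq_inv_mul, le_div_iff₀ (by positivity)]
  exact this

end Net

/-! ### Moments of the form and concentration of the Hilbert-Schmidt norm in the model. -/

section Model

variable {d p : ℕ} {Ω : Type*} [MeasurableSpace Ω] {μ : Measure Ω} {B : Ω → Tensor d p}
  {Ω' : Type*} [MeasurableSpace Ω'] {μ' : Measure Ω'} {γ : Ω' → ℂ}

lemma IsModelSC.rigid_entry (hB : IsModelSC μ B μ' γ) (i : Fin p → Fin d) :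
    IsRigidlySubGaussian μ (fun ω => B ω i) :=
  .of_identDistrib (hB.law i) (hB.rigid.const_mul _)

lemma IsModelSC.aemeasurable (hB : IsModelSC μ B μ' γ) : AEMeasurable B μ :=
  aemeasurable_pi_iff.2 fun i => (hB.rigid_entry i).aemeasurable

lemma IsModelSC.integral_norm_sq_entry (hB : IsModelSC μ B μ' γ) (i : Fin p → Fin d) :
    ∫ ω, ‖B ω i‖ ^ 2 ∂μ = (stabCard i : ℝ) / (p.factorial : ℝ) * (1 / d) := by
  have h := ((hB.law i).comp (u := fun z : ℂ => ‖z‖ ^ 2) (by fun_prop)).integral_eq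
  simp only [Function.comp_def, norm_mul, mul_pow, Complex.norm_real, Real.norm_eq_abs,
    sq_abs] at h
  rw [h, integral_const_mul, hB.variance, Real.sq_sqrt (by positivity)]

lemma diagPairing_eq_sum {T : Tensor d p} (hT : IsSymmetric T) (y : EuclideanSpace ℂ (Fin d)) :
    diagPairing T y = ∑ m : MonoTuple d p, ((p.factorial : ℂ) / (stabCard m.1 : ℂ)) *
      ((starRingEnd ℂ) (T m.1) * ∏ j, y (m.1 j)) := by
  refine sum_eq_sum_monoTuple (fun i => (starRingEnd ℂ) (T i) * ∏ j, y (i j)) fun σ i => ?_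
  rw [hT]
  congr 1
  exact Fintype.prod_equiv σ _ _ fun j => rfl

lemma hsNorm_sq_eq_sum {T : Tensor d p} (hT : IsSymmetric T) :
    hsNorm T ^ 2 = ∑ m : MonoTuple d p,
      ((p.factorial : ℝ) / (stabCard m.1 : ℝ)) * ‖T m.1‖ ^ 2 := by
  rw [hsNorm, Real.sq_sqrt (Finset.sum_nonneg fun _ _ => by positivity)]
  exact sum_eq_sum_monoTuple (fun i => ‖T i‖ ^ 2) fun σ i => by rw [hT]

/-- At a unit vector the diagonal pairing has sub-Gaussian moments of variance `1 / d`. -/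
theorem IsModelSC.diagPairing_moment [IsProbabilityMeasure μ] (hB : IsModelSC μ B μ' γ)
    {y : EuclideanSpace ℂ (Fin d)} (hy : ‖y‖ = 1) (k : ℕ) :
    Integrable (fun ω => ‖diagPairing (B ω) y‖ ^ (2 * k)) μ ∧
      ∫ ω, ‖diagPairing (B ω) y‖ ^ (2 * k) ∂μ ≤ (k.factorial : ℝ) * (1 / (d : ℝ)) ^ k := by
  set a : MonoTuple d p → ℂ := fun m => ((p.factorial : ℂ) / (stabCard m.1 : ℂ)) *
    (starRingEnd ℂ) (∏ j, y (m.1 j)) with ha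
  have hnorm : ∀ ω, ‖diagPairing (B ω) y‖ = ‖∑ m, a m * B ω m.1‖ := by
    intro ω
    rw [diagPairing_eq_sum (hB.symmetric ω), ← RCLike.norm_conj, map_sum]
    congr 1
    refine Finset.sum_congr rfl fun m _ => ?_
    simp only [ha, map_mul, map_div₀, map_natCast, Complex.conj_conj]
    ring
  have hind : iIndepFun (fun (m : MonoTuple d p) ω => a m * B ω m.1) μ :=
    hB.indep.comp (fun m z => a m * z) fun m => by fun_prop
  -- The squared orbit size times the entry's variance leaves one orbit size, so the sum unfolds to
  -- all tuples and equals `‖y‖^(2p) / d`.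
  have hvar : ∑ m : MonoTuple d p, ∫ ω, ‖a m * B ω m.1‖ ^ 2 ∂μ = 1 / (d : ℝ) := by
    have h1 : ∀ m : MonoTuple d p, ∫ ω, ‖a m * B ω m.1‖ ^ 2 ∂μ =
        ((p.factorial : ℝ) / (stabCard m.1 : ℝ)) * ‖∏ j, y (m.1 j)‖ ^ 2 * (1 / d) := by
      intro m
      simp only [norm_mul, mul_pow, integral_const_mul, hB.integral_norm_sq_entry]
      simp only [ha, norm_mul, norm_div, RCLike.norm_conj, Complex.norm_natCast]
      have hs : (stabCard m.1 : ℝ) ≠ 0 := by exact_mod_cast (stabCard_pos m.1).ne'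
      have hp : (p.factorial : ℝ) ≠ 0 := by positivity
      field_simp
    simp_rw [h1]
    rw [← Finset.sum_mul, ← sum_eq_sum_monoTuple (fun i => ‖∏ j, y (i j)‖ ^ 2),
      sum_norm_prod_sq (fun _ => y)]
    · simp [hy]
    · intro σ i
      congr 2
      exact Fintype.prod_equiv σ _ _ fun j => rfl
  have := integral_norm_sum_pow_le (fun m => (hB.rigid_entry m.1).const_mul (a m)) hind
    Finset.univ k
  rw [hvar] at this
  simpa only [hnorm] using this

/-- The Hilbert-Schmidt norm of `B` concentrates, by Chebyshev's inequality. -/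
theorem IsModelSC.hsNorm_lower_tail [IsProbabilityMeasure μ] (hB : IsModelSC μ B μ' γ)
    (hd : 1 ≤ d) {η : ℝ} (hη : 0 < η) :
    μ.real {ω | hsNorm (B ω) ^ 2 ≤ (1 - η) * (Fintype.card (MonoTuple d p) / (d : ℝ))} ≤
      1 / (η ^ 2 * Fintype.card (MonoTuple d p)) := by
  set N : ℝ := ((Fintype.card (MonoTuple d p) : ℕ) : ℝ) with hN
  have hd0 : (0 : ℝ) < d := by exact_mod_cast hd
  have hNpos : 0 < N := by
    have : Nonempty (MonoTuple d p) := ⟨⟨fun _ => ⟨0, hd⟩, fun _ _ _ => le_rfl⟩⟩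
    rw [hN]; exact_mod_cast Fintype.card_pos
  set W : MonoTuple d p → Ω → ℝ := fun m ω =>
    ((p.factorial : ℝ) / (stabCard m.1 : ℝ)) * ‖B ω m.1‖ ^ 2 with hW
  have hr : ∀ m : MonoTuple d p,
      ((p.factorial : ℝ) / (stabCard m.1 : ℝ)) * ((stabCard m.1 : ℝ) / (p.factorial : ℝ)) = 1 := by
    intro m
    have hs : (stabCard m.1 : ℝ) ≠ 0 := by exact_mod_cast (stabCard_pos m.1).ne'
    have hp : (p.factorial : ℝ) ≠ 0 := by positivity
    field_simp
  have hWm : ∀ m, AEMeasurable (W m) μ := fun m =>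
    ((hB.rigid_entry m.1).aemeasurable.norm.pow_const 2).const_mul _
  have hWsq : ∀ m ω, W m ω ^ 2 =
      ((p.factorial : ℝ) / (stabCard m.1 : ℝ)) ^ 2 * ‖B ω m.1‖ ^ (2 * 2) := fun m ω => by
    simp only [hW]; ring
  have hWL : ∀ m, MemLp (W m) 2 μ := fun m => by
    rw [memLp_two_iff_integrable_sq (hWm m).aestronglyMeasurable]
    simp_rw [hWsq]
    exact ((hB.rigid_entry m.1).moment_integrable 2).const_mul _
  have hWmean : ∀ m, ∫ ω, W m ω ∂μ = 1 / d := fun m => by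
    simp only [hW, integral_const_mul, hB.integral_norm_sq_entry]
    rw [← mul_assoc, hr, one_mul]
  -- The fourth-moment bound gives second moment at most `2/d²` for `W m`, and the squared mean
  -- removes `1/d²`.
  have hWvar : ∀ m, Var[W m; μ] ≤ (1 / (d : ℝ)) ^ 2 := fun m => by
    rw [variance_eq_sub (hWL m), hWmean]
    have h2 : ∫ ω, (W m ^ 2) ω ∂μ ≤ 2 * (1 / (d : ℝ)) ^ 2 := by
      simp only [Pi.pow_apply, hWsq, integral_const_mul]
      have h3 := (hB.rigid_entry m.1).moment_le 2
      rw [hB.integral_norm_sq_entry] at h3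
      calc _ ≤ ((p.factorial : ℝ) / (stabCard m.1 : ℝ)) ^ 2 * (((2 : ℕ).factorial : ℝ) *
            ((stabCard m.1 : ℝ) / (p.factorial : ℝ) * (1 / d)) ^ 2) := by gcongr
        _ = 2 * ((((p.factorial : ℝ) / (stabCard m.1 : ℝ)) *
            ((stabCard m.1 : ℝ) / (p.factorial : ℝ))) * (1 / (d : ℝ))) ^ 2 := by
            rw [Nat.factorial_two]; push_cast; ring
        _ = _ := by rw [hr, one_mul]
    linarith
  have hind : iIndepFun W μ :=
    hB.indep.comp (fun m z => ((p.factorial : ℝ) / (stabCard m.1 : ℝ)) * ‖z‖ ^ 2)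
      fun m => by fun_prop
  have hH : ∀ ω, hsNorm (B ω) ^ 2 = (∑ m, W m) ω := fun ω => by
    rw [hsNorm_sq_eq_sum (hB.symmetric ω), Finset.sum_apply]
  have hmean : ∫ ω, (∑ m, W m) ω ∂μ = N / d := by
    simp only [Finset.sum_apply]
    rw [integral_finsetSum _ fun m _ => (hWL m).integrable (by norm_num)]
    simp only [hWmean, Finset.sum_const, Finset.card_univ, nsmul_eq_mul]
    rw [hN]; ring
  have hvar : Var[∑ m, W m; μ] ≤ N * (1 / (d : ℝ)) ^ 2 := by
    rw [IndepFun.variance_sum (fun m _ => hWL m) fun m _ m' _ h => hind.indepFun h]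
    refine (Finset.sum_le_sum fun m _ => hWvar m).trans_eq ?_
    rw [Finset.sum_const, Finset.card_univ, nsmul_eq_mul]
  have hc : 0 < η * (N / d) := by positivity
  have hch := meas_ge_le_variance_div_sq (memLp_finsetSum' Finset.univ fun m _ => hWL m) hc
  have hsub : {ω | hsNorm (B ω) ^ 2 ≤ (1 - η) * (N / (d : ℝ))} ⊆
      {ω | η * (N / d) ≤ |(∑ m, W m) ω - ∫ ω, (∑ m, W m) ω ∂μ|} := by
    intro ω hω
    rw [Set.mem_ofPred_eq, hH] at hω
    rw [Set.mem_ofPred_eq, hmean, abs_sub_comm]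
    exact le_trans (by linarith) (le_abs_self _)
  calc μ.real {ω | hsNorm (B ω) ^ 2 ≤ (1 - η) * (N / (d : ℝ))}
      ≤ Var[∑ m, W m; μ] / (η * (N / d)) ^ 2 :=
        ENNReal.toReal_le_of_le_ofReal (div_nonneg (variance_nonneg _ _) (by positivity))
          ((measure_mono hsub).trans hch)
    _ ≤ N * (1 / (d : ℝ)) ^ 2 / (η * (N / d)) ^ 2 := by gcongr
    _ = 1 / (η ^ 2 * N) := by field_simp

end Model

/-! ### The expectation bound with free parameters. -/

section Bound

variable {d p : ℕ} {Ω : Type*} [MeasurableSpace Ω] {μ : Measure Ω} {B : Ω → Tensor d p}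
  {Ω' : Type*} [MeasurableSpace Ω'] {μ' : Measure Ω'} {γ : Ω' → ℂ}

lemma IsModelSC.integrable_injNorm_normalise [IsProbabilityMeasure μ]
    (hB : IsModelSC μ B μ' γ) : Integrable (fun ω => injNorm (normalise (B ω))) μ := by
  refine (integrable_const (1 : ℝ)).mono'
    (measurable_injNorm_normalise.comp_aemeasurable hB.aemeasurable).aestronglyMeasurable
    (.of_forall fun ω => ?_)
  rw [Real.norm_of_nonneg (injNorm_nonneg _)]
  exact injNorm_normalise_le_one _

lemma measurable_hsNorm : Measurable (hsNorm : Tensor d p → ℝ) := by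
  unfold hsNorm
  fun_prop

/-- Bounds a maximum over the net in expectation directly by a sum of moments, with no integration
of tails. -/
lemma le_mul_one_add_pow {x t : ℝ} (hx : 0 ≤ x) (ht : 0 < t) {n : ℕ} (hn : 1 ≤ n) :
    x ≤ t * (1 + (x / t) ^ n) := by
  have hu : 0 ≤ x / t := by positivity
  have h : x / t ≤ 1 + (x / t) ^ n := by
    rcases le_total (x / t) 1 with h1 | h1
    · linarith [pow_nonneg hu n]
    · linarith [le_self_pow₀ h1 (by omega : n ≠ 0)]
  calc x = t * (x / t) := by field_simp
    _ ≤ _ := by gcongr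

/-- The expected injective norm of the normalised tensor, in terms of the size of the net, a
moment order `k`, a threshold `θ` and a concentration parameter `η`. -/
theorem IsModelSC.integral_injNorm_normalise_le [IsProbabilityMeasure μ]
    (hB : IsModelSC μ B μ' γ) (hd : 1 ≤ d) (hp : 1 ≤ p) {m : ℕ} (hm : 1 ≤ m) {s : ℝ}
    (hs0 : 0 < s) (hs : s ≤ 1 / 8) (hms : 64 * (d : ℝ) * p ≤ s ^ 2 * (m : ℝ) ^ 2) {η : ℝ}
    (hη0 : 0 < η) (hη1 : η < 1) {k : ℕ} (hk : 1 ≤ k) {θ : ℝ} (hθ : 0 < θ) :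
    ∫ ω, injNorm (normalise (B ω)) ∂μ ≤ 1 / (η ^ 2 * Fintype.card (MonoTuple d p)) +
      Real.sqrt (θ / ((1 - η) * Fintype.card (MonoTuple d p))) / (1 - 5 * s) *
        (1 + Fintype.card (NetIndex d m) * (k.factorial / θ ^ k)) := by
  have htail := hB.hsNorm_lower_tail hd hη0
  set N : ℝ := ((Fintype.card (MonoTuple d p) : ℕ) : ℝ) with hN
  have hd0 : (0 : ℝ) < d := by exact_mod_cast hd
  have hNpos : 0 < N := by
    have : Nonempty (MonoTuple d p) := ⟨⟨fun _ => ⟨0, hd⟩, fun _ _ _ => le_rfl⟩⟩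
    rw [hN]; exact_mod_cast Fintype.card_pos
  have hη1' : 0 < 1 - η := by linarith
  have hs5 : 0 < 1 - 5 * s := by linarith
  set t : ℝ := Real.sqrt (θ / d) with ht
  have ht0 : 0 < t := Real.sqrt_pos.2 (by positivity)
  set h₀ : ℝ := Real.sqrt ((1 - η) * (N / d)) with hh₀
  have hh₀pos : 0 < h₀ := Real.sqrt_pos.2 (by positivity)
  set bad : Set Ω := {ω | hsNorm (B ω) ^ 2 ≤ (1 - η) * (N / d)} with hbad
  set c : ℝ := t / (h₀ * (1 - 5 * s)) with hc
  have hc0 : 0 < c := by positivity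
  have hbadm : NullMeasurableSet bad μ :=
    nullMeasurableSet_le ((measurable_hsNorm.comp_aemeasurable hB.aemeasurable).pow_const 2)
      aemeasurable_const
  -- Majorant: the trivial bound `1` where the Hilbert-Schmidt norm is small; elsewhere that norm is
  -- at least `h₀`, and the sum over the net dominates the one point that nearly attains the
  -- maximum.
  set F : Ω → ℝ := fun ω => bad.indicator 1 ω +
    c * (1 + ∑ q : NetIndex d m, ‖diagPairing (B ω) (netUnit q)‖ ^ (2 * k) * (t ^ (2 * k))⁻¹)
    with hF
  have hpt : ∀ ω, injNorm (normalise (B ω)) ≤ F ω := by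
    intro ω
    have hsum : 0 ≤ c * (1 + ∑ q : NetIndex d m,
        ‖diagPairing (B ω) (netUnit q)‖ ^ (2 * k) * (t ^ (2 * k))⁻¹) := by
      have := Finset.sum_nonneg (s := Finset.univ) (f := fun q : NetIndex d m =>
        ‖diagPairing (B ω) (netUnit q)‖ ^ (2 * k) * (t ^ (2 * k))⁻¹) fun q _ => by positivity
      positivity
    by_cases hω : ω ∈ bad
    · have := injNorm_normalise_le_one (B ω)
      simp only [hF, Set.indicator_of_mem hω, Pi.one_apply]
      linarith
    · simp only [hF, Set.indicator_of_notMem hω, zero_add]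
      have hh : h₀ ≤ hsNorm (B ω) :=
        Real.sqrt_le_iff.2 ⟨hsNorm_nonneg _, (not_le.1 hω).le⟩
      obtain ⟨q, hq⟩ := exists_netUnit_le hm hd hp hs0 hs hms (hB.symmetric ω)
      have h1 := le_mul_one_add_pow (norm_nonneg (diagPairing (B ω) (netUnit q))) ht0
        (n := 2 * k) (by omega)
      have h2 : (‖diagPairing (B ω) (netUnit q)‖ / t) ^ (2 * k) ≤ ∑ q : NetIndex d m,
          ‖diagPairing (B ω) (netUnit q)‖ ^ (2 * k) * (t ^ (2 * k))⁻¹ := by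
        rw [div_pow, div_eq_mul_inv]
        exact Finset.single_le_sum (f := fun q : NetIndex d m =>
          ‖diagPairing (B ω) (netUnit q)‖ ^ (2 * k) * (t ^ (2 * k))⁻¹)
          (fun q _ => by positivity) (Finset.mem_univ q)
      calc injNorm (normalise (B ω)) ≤ injNorm (B ω) / hsNorm (B ω) := injNorm_normalise _
        _ ≤ injNorm (B ω) / h₀ := by
            gcongr
            exact injNorm_nonneg _
        _ = ((1 - 5 * s) * injNorm (B ω)) / (h₀ * (1 - 5 * s)) := by field_simp
        _ ≤ (t * (1 + (‖diagPairing (B ω) (netUnit q)‖ / t) ^ (2 * k))) /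
            (h₀ * (1 - 5 * s)) := by
            exact div_le_div_of_nonneg_right (hq.trans h1) (by positivity)
        _ = c * (1 + (‖diagPairing (B ω) (netUnit q)‖ / t) ^ (2 * k)) := by rw [hc]; ring
        _ ≤ _ := by gcongr
  have hmom := fun q : NetIndex d m => hB.diagPairing_moment (norm_netUnit q) k
  have hi1 : Integrable (bad.indicator (1 : Ω → ℝ)) μ :=
    (integrable_const (1 : ℝ)).indicator₀ hbadm
  have hi2 : Integrable (fun ω => ∑ q : NetIndex d m,
      ‖diagPairing (B ω) (netUnit q)‖ ^ (2 * k) * (t ^ (2 * k))⁻¹) μ :=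
    integrable_finsetSum _ fun q _ => (hmom q).1.mul_const _
  have hi3 : Integrable (fun ω => c * (1 + ∑ q : NetIndex d m,
      ‖diagPairing (B ω) (netUnit q)‖ ^ (2 * k) * (t ^ (2 * k))⁻¹)) μ :=
    ((integrable_const (1 : ℝ)).add hi2).const_mul c
  have hFint : ∫ ω, F ω ∂μ = μ.real bad + c * (1 + ∑ q : NetIndex d m,
      (∫ ω, ‖diagPairing (B ω) (netUnit q)‖ ^ (2 * k) ∂μ) * (t ^ (2 * k))⁻¹) := by
    simp only [hF]
    rw [integral_add hi1 hi3, integral_const_mul, integral_add (integrable_const _) hi2,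
      integral_finsetSum _ fun q _ => (hmom q).1.mul_const _, integral_indicator₀ hbadm]
    simp [integral_mul_const]
  have hct : c = Real.sqrt (θ / ((1 - η) * N)) / (1 - 5 * s) := by
    rw [hc, ← div_div, ht, hh₀, ← Real.sqrt_div (by positivity)]
    congr 2
    field_simp
  have ht2 : t ^ (2 * k) = θ ^ k * (1 / (d : ℝ)) ^ k := by
    rw [pow_mul, ht, Real.sq_sqrt (by positivity), ← mul_pow]
    congr 1; ring
  calc ∫ ω, injNorm (normalise (B ω)) ∂μ ≤ ∫ ω, F ω ∂μ :=
        integral_mono hB.integrable_injNorm_normalise (hi1.add hi3) hpt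
    _ ≤ 1 / (η ^ 2 * N) + c * (1 + ∑ _q : NetIndex d m,
          ((k.factorial : ℝ) * (1 / (d : ℝ)) ^ k) * (t ^ (2 * k))⁻¹) := by
        rw [hFint]
        gcongr with q _
        exact (hmom q).2
    _ = _ := by
        rw [hct, Finset.sum_const, Finset.card_univ, nsmul_eq_mul, ht2]
        have : (1 / (d : ℝ)) ^ k ≠ 0 := by positivity
        have : θ ^ k ≠ 0 := by positivity
        field_simp

end Bound

/-! ### Choice of the moment order and bookkeeping of constants. -/

section Asymptotics

open Filter Topology

/-- Crude Stirling bound, by induction from `(k/(k+1))^(k+1) ≤ 1/e`. Its polynomial loss in `k` is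
harmless against the later factor `(1 + ρ)^(-k)`. -/
lemma factorial_le_mul_exp {k : ℕ} (hk : 1 ≤ k) :
    (k.factorial : ℝ) ≤ k * (k : ℝ) ^ k * Real.exp (1 - k) := by
  induction k, hk using Nat.le_induction with
  | base => simp
  | succ k hk ih =>
    have hk0 : (0 : ℝ) < k := by exact_mod_cast hk
    have h1 : (k : ℝ) / (k + 1) ≤ Real.exp (-(1 / (k + 1))) := by
      have := Real.add_one_le_exp (-(1 / ((k : ℝ) + 1)))
      refine le_trans (le_of_eq ?_) this
      field_simp
      ring
    have h2 : ((k : ℝ) / (k + 1)) ^ (k + 1) ≤ Real.exp (-1) := by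
      refine (pow_le_pow_left₀ (by positivity) h1 _).trans_eq ?_
      rw [← Real.exp_nat_mul]
      congr 1
      push_cast
      field_simp
    rw [div_pow, div_le_iff₀ (by positivity)] at h2
    rw [Nat.factorial_succ]
    push_cast
    calc ((k : ℝ) + 1) * k.factorial ≤ (k + 1) * (k * (k : ℝ) ^ k * Real.exp (1 - k)) := by gcongr
      _ = (k + 1) * (k : ℝ) ^ (k + 1) * Real.exp (1 - k) := by ring
      _ ≤ (k + 1) * (Real.exp (-1) * (k + 1) ^ (k + 1)) * Real.exp (1 - k) := by gcongr
      _ = (k + 1) * ((k : ℝ) + 1) ^ (k + 1) * (Real.exp (-1) * Real.exp (1 - k)) := by ring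
      _ = _ := by rw [← Real.exp_add]; congr 2; ring

/-- Since `k ≥ D log p`, the factor `p^D` from the net is at most `e^k` and cancels Stirling's
`e^(-k)`. The slack `1 + ρ` in the threshold leaves geometric decay. -/
lemma net_term_le {D A p k : ℕ} {ρ : ℝ} (hρ : 0 < ρ) (hp : 1 ≤ p) (hk : 1 ≤ k)
    (hDk : (D : ℝ) * Real.log p ≤ k) {Q : ℝ}
    (hQ : Q ≤ (D + 1) * (4 * (A : ℝ) ^ 2 * p) ^ D) :
    Q * (k.factorial / ((1 + ρ) * k) ^ k) ≤
      (D + 1) * (4 * (A : ℝ) ^ 2) ^ D * Real.exp 1 * (k * ((1 + ρ)⁻¹) ^ k) := by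
  have hp0 : (0 : ℝ) < p := by exact_mod_cast hp
  have hk0 : (0 : ℝ) < k := by exact_mod_cast hk
  have hpD : (p : ℝ) ^ D ≤ Real.exp k := by
    calc (p : ℝ) ^ D = Real.exp (D * Real.log p) := by
          rw [Real.exp_nat_mul, Real.exp_log hp0]
      _ ≤ _ := Real.exp_le_exp.2 hDk
  have hρ' : (0 : ℝ) < (1 + ρ) ^ k := by positivity
  calc Q * (k.factorial / ((1 + ρ) * k) ^ k)
      ≤ ((D + 1) * (4 * (A : ℝ) ^ 2 * p) ^ D) *
          ((k * (k : ℝ) ^ k * Real.exp (1 - k)) / ((1 + ρ) * k) ^ k) := by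
        gcongr
        exact factorial_le_mul_exp hk
    _ = (D + 1) * (4 * (A : ℝ) ^ 2) ^ D * ((p : ℝ) ^ D * Real.exp (1 - k)) *
          (k * ((1 + ρ)⁻¹) ^ k) := by
        rw [mul_pow _ (p : ℝ), mul_pow (1 + ρ), inv_pow]
        field_simp
    _ ≤ (D + 1) * (4 * (A : ℝ) ^ 2) ^ D * (Real.exp k * Real.exp (1 - k)) *
          (k * ((1 + ρ)⁻¹) ^ k) := by gcongr
    _ = _ := by rw [← Real.exp_add]; congr 3; ring

/-- Here `a` stands for `D!/p^D`, `Λ` for `D log p` and `κ` for the moment order. The Chebyshev term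
is of order `a`, hence negligible against `√(aΛ)` once `a ≤ ρ^6 Λ`. -/
lemma chebyshev_add_net_term_le {ρ ε N a Λ κ Q : ℝ} (hρ0 : 0 < ρ) (hρ1 : ρ ≤ 1 / 2) (hρε : 17 * ρ ≤ ε)
    (hN : 0 < N) (ha0 : 0 < a) (hNa : 1 / N ≤ a) (hΛ0 : 0 < Λ) (haΛ : a ≤ ρ ^ 2 * ρ ^ 4 * Λ)
    (hκ : κ ≤ (1 + ρ) * Λ) (hQ0 : 0 ≤ Q) (hQ : Q ≤ ρ) :
    1 / (ρ ^ 2 * N) + Real.sqrt ((1 + ρ) * κ / ((1 - ρ) * N)) / (1 - 5 * (ρ / 5)) * (1 + Q) ≤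
      (1 + ε) * Real.sqrt (a * Λ) := by
  have h1ρ : 0 < 1 - ρ := by linarith
  set R : ℝ := Real.sqrt (a * Λ) with hR
  have hR0 : 0 ≤ R := Real.sqrt_nonneg _
  have hfirst : 1 / (ρ ^ 2 * N) ≤ ρ * R := by
    calc 1 / (ρ ^ 2 * N) = 1 / N / ρ ^ 2 := by rw [div_div, mul_comm]
      _ ≤ a / ρ ^ 2 := by gcongr
      _ ≤ Real.sqrt (ρ ^ 2 * (a * Λ)) := by
        refine Real.le_sqrt_of_sq_le ?_
        rw [div_pow, div_le_iff₀ (by positivity)]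
        calc a ^ 2 = a * a := sq a
          _ ≤ a * (ρ ^ 2 * ρ ^ 4 * Λ) := by gcongr
          _ = _ := by ring
      _ = ρ * R := by rw [Real.sqrt_mul (by positivity), Real.sqrt_sq hρ0.le]
  have hsecond : Real.sqrt ((1 + ρ) * κ / ((1 - ρ) * N)) ≤ (1 + ρ) / (1 - ρ) * R := by
    rw [Real.sqrt_le_left (by positivity), mul_pow, hR, Real.sq_sqrt (by positivity)]
    calc (1 + ρ) * κ / ((1 - ρ) * N) = (1 + ρ) * κ / (1 - ρ) * (1 / N) := by
          rw [← div_div]; ring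
      _ ≤ (1 + ρ) * ((1 + ρ) * Λ) / (1 - ρ) * a := by gcongr
      _ = (1 + ρ) ^ 2 * (a * Λ) / (1 - ρ) := by ring
      _ ≤ (1 + ρ) ^ 2 * (a * Λ) / (1 - ρ) ^ 2 := by
          gcongr
          nlinarith
      _ = _ := by rw [div_pow]; ring
  have hfrac : (1 + ρ) / (1 - ρ) ≤ 1 + 4 * ρ := by
    rw [div_le_iff₀ h1ρ]
    nlinarith
  have hfrac0 : 0 ≤ (1 + ρ) / (1 - ρ) := div_nonneg (by linarith) h1ρ.le
  calc _ ≤ ρ * R + (1 + ρ) / (1 - ρ) * R / (1 - 5 * (ρ / 5)) * (1 + ρ) := by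
        have : 0 ≤ 1 - 5 * (ρ / 5) := by linarith
        gcongr
    _ = (ρ + ((1 + ρ) / (1 - ρ)) ^ 2) * R := by
        rw [show 1 - 5 * (ρ / 5) = 1 - ρ by ring]; ring
    _ ≤ (ρ + (1 + 4 * ρ) ^ 2) * R := by gcongr
    -- As `ρ ≤ 1/2`, `ρ + (1 + 4ρ)² = 1 + 9ρ + 16ρ² ≤ 1 + 17ρ`.
    _ ≤ (1 + ε) * R := mul_le_mul_of_nonneg_right (by nlinarith) hR0

end Asymptotics

end SymTensor

end

/-! ### The corollary. -/

open SymTensor in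
theorem corollaryD3 (d : ℕ) (hd : 2 ≤ d) (ε : ℝ) (hε : 0 < ε) :
    ∃ p₀ : ℕ, ∀ p : ℕ, p₀ ≤ p →
      ∀ (Ω : Type*) [MeasurableSpace Ω] (μ : Measure Ω) [IsProbabilityMeasure μ]
        (Ω' : Type*) [MeasurableSpace Ω'] (μ' : Measure Ω') [IsProbabilityMeasure μ']
        (γ : Ω' → ℂ) (B : Ω → SymTensor.Tensor d p),
        SymTensor.IsModelSC μ B μ' γ →
          Integrable (fun ω => SymTensor.injNorm (SymTensor.normalise (B ω))) μ ∧
          ∫ ω, SymTensor.injNorm (SymTensor.normalise (B ω)) ∂μ ≤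
            (1 + ε) * Real.sqrt
              (((d - 1).factorial : ℝ) * ((d : ℝ) - 1) * Real.log (p : ℝ) /
                (p : ℝ) ^ (d - 1)) := by
  obtain ⟨D, rfl⟩ : ∃ D, d = D + 1 := ⟨d - 1, by omega⟩
  have hD : 1 ≤ D := by omega
  have hD0 : (0 : ℝ) < D := by exact_mod_cast hD
  obtain ⟨ρ, hρ0, hρ1, hρε⟩ : ∃ ρ : ℝ, 0 < ρ ∧ ρ ≤ 1 / 2 ∧ 17 * ρ ≤ ε :=
    ⟨min (1 / 2) (ε / 17), by positivity, min_le_left _ _, by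
      have := min_le_right (1 / 2) (ε / 17); linarith⟩
  obtain ⟨A, hA⟩ := exists_nat_gt (64 * ((D : ℝ) + 1) / (ρ / 5) ^ 2)
  have hA0 : (0 : ℝ) < A := lt_trans (by positivity) hA
  have hA1 : 1 ≤ A := by exact_mod_cast hA0
  have hA2 : 64 * ((D : ℝ) + 1) ≤ (ρ / 5) ^ 2 * (A : ℝ) ^ 2 := by
    rw [div_lt_iff₀ (by positivity)] at hA
    have h1 : (1 : ℝ) ≤ A := by exact_mod_cast hA1
    nlinarith [sq_nonneg (ρ / 5)]
  have hL : Filter.Tendsto (fun p : ℕ => (D : ℝ) * Real.log p) Filter.atTop Filter.atTop :=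
    (Real.tendsto_log_atTop.comp tendsto_natCast_atTop_atTop).const_mul_atTop hD0
  have hK : Filter.Tendsto (fun p : ℕ => ⌈(D : ℝ) * Real.log p⌉₊) Filter.atTop Filter.atTop :=
    tendsto_nat_ceil_atTop.comp hL
  have hsmall : Filter.Tendsto (fun k : ℕ => ((D : ℝ) + 1) * (4 * (A : ℝ) ^ 2) ^ D * Real.exp 1 *
      (k * ((1 + ρ)⁻¹) ^ k)) Filter.atTop (nhds 0) := by
    have := (tendsto_self_mul_const_pow_of_lt_one (r := (1 + ρ)⁻¹) (by positivity)
      (inv_lt_one_of_one_lt₀ (by linarith))).const_mul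
      (((D : ℝ) + 1) * (4 * (A : ℝ) ^ 2) ^ D * Real.exp 1)
    simpa using this
  -- The conditions involve only `p`, `d` and `ε`, so `p₀` is uniform over the model. In order: the
  -- net term is below `ρ`, rounding `Λ` up costs a factor at most `1 + ρ`, and the Chebyshev term
  -- is negligible.
  have hev := ((hsmall.comp hK).eventually (gt_mem_nhds hρ0)).and
    ((hL.eventually_ge_atTop (1 / ρ)).and
      ((hL.eventually_ge_atTop ((D.factorial : ℝ) / (ρ ^ 2 * ρ ^ 4))).and
        (Filter.eventually_ge_atTop 1)))
  obtain ⟨p₀, hp₀⟩ := Filter.eventually_atTop.1 hev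
  refine ⟨p₀, fun p hpp Ω _ μ _ Ω' _ μ' _ γ B hB => ⟨hB.integrable_injNorm_normalise, ?_⟩⟩
  obtain ⟨hsm, hL1, hL2, hp1⟩ := hp₀ p hpp
  simp only [Function.comp_apply] at hsm
  set Λ : ℝ := (D : ℝ) * Real.log p with hΛ
  set k : ℕ := ⌈Λ⌉₊ with hk
  have hp0 : (0 : ℝ) < p := by exact_mod_cast hp1
  have hΛ0 : 0 < Λ := lt_of_lt_of_le (by positivity) hL1
  have hk1 : 1 ≤ k := Nat.one_le_iff_ne_zero.2 (Nat.ceil_pos.2 hΛ0).ne'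
  have hk0 : (0 : ℝ) < k := by exact_mod_cast hk1
  have hΛk : Λ ≤ k := Nat.le_ceil _
  have hkΛ : (k : ℝ) ≤ (1 + ρ) * Λ := by
    have h1 := (Nat.ceil_lt_add_one hΛ0.le).le
    rw [div_le_iff₀ hρ0] at hL1
    linarith
  -- An integer of size about `√p`; the grid has `A * r` steps, with `A` independent of `p`, so its
  -- mesh is a small multiple of `1/√p`.
  set r := Nat.sqrt p + 1 with hr
  have hr1 : p ≤ r ^ 2 := (Nat.lt_succ_sqrt' p).le
  have hr2 : r ^ 2 ≤ 4 * p := by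
    have h1 := Nat.sqrt_le' p
    have h2 : 1 ≤ Nat.sqrt p := Nat.sqrt_pos.2 hp1
    rw [hr]; nlinarith
  have hr1' : (p : ℝ) ≤ (r : ℝ) ^ 2 := by exact_mod_cast hr1
  have hr2' : (r : ℝ) ^ 2 ≤ 4 * p := by exact_mod_cast hr2
  have hmain := hB.integral_injNorm_normalise_le (m := A * r) (s := ρ / 5) (η := ρ) (k := k)
    (θ := (1 + ρ) * k) (by omega) hp1 (Nat.mul_pos hA1 (Nat.succ_pos _)) (by positivity)
    (by linarith) (by
      push_cast
      calc 64 * ((D : ℝ) + 1) * p ≤ ((ρ / 5) ^ 2 * (A : ℝ) ^ 2) * (r : ℝ) ^ 2 := by gcongr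
        _ = _ := by ring) hρ0 (by linarith) hk1 (by positivity)
  have hnet := net_term_le (D := D) (A := A) (p := p) (k := k) hρ0 hp1 hk1 hΛk
    (Q := Fintype.card (NetIndex (D + 1) (A * r))) (by
      rw [card_netIndex, Nat.add_sub_cancel]
      push_cast
      refine mul_le_mul_of_nonneg_left (pow_le_pow_left₀ (by positivity) ?_ _) (by positivity)
      calc (A : ℝ) * r * (A * r) = (A : ℝ) ^ 2 * (r : ℝ) ^ 2 := by ring
        _ ≤ (A : ℝ) ^ 2 * (4 * p) := by gcongr
        _ = _ := by ring)
  set N : ℝ := ((Fintype.card (MonoTuple (D + 1) p) : ℕ) : ℝ) with hN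
  set a : ℝ := (D.factorial : ℝ) / (p : ℝ) ^ D with ha
  have ha0 : 0 < a := by positivity
  have hNa : 1 / N ≤ a := by
    have h1 := card_monoTuple_ge (d := D + 1) (p := p) (by omega)
    rw [Nat.add_sub_cancel] at h1
    have h2 := one_div_le_one_div_of_le (by positivity) h1
    rwa [one_div_div] at h2
  have hgoal : Real.sqrt (((D + 1 - 1).factorial : ℝ) * (((D + 1 : ℕ) : ℝ) - 1) * Real.log (p : ℝ) /
      (p : ℝ) ^ (D + 1 - 1)) = Real.sqrt (a * Λ) := by
    rw [ha, hΛ, Nat.add_sub_cancel]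
    congr 1
    push_cast
    ring
  have haΛ : a ≤ ρ ^ 2 * ρ ^ 4 * Λ := by
    have haD : a ≤ D.factorial := by
      rw [ha]
      exact div_le_self (by positivity) (one_le_pow₀ (by exact_mod_cast hp1))
    rw [div_le_iff₀ (by positivity)] at hL2
    linarith
  have hNpos : 0 < N := by
    have : Nonempty (MonoTuple (D + 1) p) := ⟨⟨fun _ => 0, fun _ _ _ => le_rfl⟩⟩
    rw [hN]; exact_mod_cast Fintype.card_pos
  rw [hgoal]
  exact hmain.trans (chebyshev_add_net_term_le hρ0 hρ1 hρε hNpos ha0 hNa hΛ0 haΛ hkΛ (by positivity)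
    (hnet.trans hsm.le))
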